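/- Theorem. Consider the sale of a single item to $m$ bidders. Bidder $i$ has a finite type set $T_i$, and the types $t_1,\dots,t_m$ are independent (not necessarily identically distributed) random variables, $t_i\in T_i$. A reduced form is a vector $\pi=(\pi_i(A))_{i,\,A\in T_i}$ with entries in $[0,1]$. It is feasible if there is a randomized mechanism (one that gives the item to bidder $i$ with probability $\phi_i(t)\ge 0$ when the profile $t$ is reported, where $\sum_i\phi_i(t)\le 1$ for every profile $t$) such that, for all $i$ and all $A\in T_i$, bidder $i$ receives the item with probability at least $\pi_i(A)$ when she reports $A$ and the types of the other bidders are drawn from their distribution, i.e. $\mathbb{E}_{t_{-i}}[\phi_i(A;t_{-i})]\ge \pi_i(A)$. Define the virtual reduced form by $$\hat\pi_i(A)=\Pr[\pi_i(t_i)\le \pi_i(A)]\cdot \pi_i(A).$$ (1) A reduced form $\pi$ is feasible if and only if, for every $x\in\mathbb{R}$, the sets $S^{(i)}_x=\{A\in T_i:\hat\pi_i(A)>x\}$ satisfy $$\sum_i\sum_{A\in S^{(i)}_x}\pi_i(A)\Pr[t_i=A]\;\le\;1-\prod_i\bigl(1-\Pr[t_i\in S^{(i)}_x]\bigr).$$ (2)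 There are a single real-RAM program (unit cost per arithmetic operation, comparison and memory access; the only real constants in the program are rational) and an absolute constant $C$ such that the following holds for every $m\ge 1$ and every instance as above, with $N=\sum_i|T_i|$. Given $N$, $m$ and, for each pair $(i,A)$ with $A\in T_i$ (listed in any order), the bidder $i$ and the numbers $\pi_i(A)$ and $\Pr[t_i=A]$, the program halts after at most $C\cdot N(\log N+m)$ steps. It reports correctly whether $\pi$ is feasible, and if $\pi$ is infeasible it also outputs a vector $w\ne 0$ and a number $b$ that define a hyperplane separating $\pi$ from the set of feasible reduced forms: $\sum_{i}\sum_{A\in T_i} w_i(A)\,\rho_i(A)\le b$ for every feasible reduced form $\rho$, while $\sum_{i}\sum_{A\in T_i} w_i(A)\,\pi_i(A)>b$. -/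

import Mathlib

open MeasureTheory ProbabilityTheory

universe u

/-! ## Single-item auctions with finitely many types

There are `m` bidders, `T i` is the (finite) type set of bidder `i`, a type profile is an element
`t : ∀ i, T i`, and `D` is the joint distribution of the type profile. -/

namespace Auction

section Forms

variable {m : ℕ} {T : Fin m → Type u}

/-- A (direct, randomized) single-item mechanism: `alloc t i` is the probability, over the internal
randomness of the mechanism, that bidder `i` receives the item when the profile `t` is reported.
The item is never over-allocated. -/
structure Mechanism (T : Fin m → Type u) where
  alloc : (∀ i, T i) → Fin m → ℝ
  alloc_nonneg : ∀ t i, 0 ≤ alloc t i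
  sum_alloc_le_one : ∀ t, ∑ i, alloc t i ≤ 1

/-- A single-item reduced form: a vector in `[0, 1]^(∑ i, |T i|)`. -/
def IsReducedForm (π : ∀ i, T i → ℝ) : Prop :=
  ∀ i A, 0 ≤ π i A ∧ π i A ≤ 1

/-- The hyperplane `{y | ∑ᵢ ∑_A wᵢ(A) yᵢ(A) = b}` separates the point `π` from the set `K`. -/
def Separates [∀ i, Fintype (T i)] (w : ∀ i, T i → ℝ) (b : ℝ) (π : ∀ i, T i → ℝ) (K : Set (∀ i, T i → ℝ)) : Prop :=
  w ≠ 0 ∧ (∀ y ∈ K, ∑ i, ∑ A, w i A * y i A ≤ b) ∧ b < ∑ i, ∑ A, w i A * π i A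

variable [∀ i, MeasurableSpace (T i)]

/-- The probability that bidder `i` receives the item when she reports `A` and the types of the
other bidders are drawn from the marginal of `D` on the other coordinates. -/
noncomputable def Mechanism.interim (M : Mechanism T) (D : Measure (∀ i, T i))
    (i : Fin m) (A : T i) : ℝ :=
  ∫ t, M.alloc (Function.update t i A) i ∂D

/-- `M` implements `π` if every type of every bidder receives the item with probability at least
the one prescribed by `π`. -/
def Mechanism.Implements (M : Mechanism T) (D : Measure (∀ i, T i)) (π : ∀ i, T i → ℝ) : Prop :=
  ∀ i A, π i A ≤ M.interim D i A

/-- A reduced form is feasible if some mechanism implements it. -/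
def Feasible (D : Measure (∀ i, T i)) (π : ∀ i, T i → ℝ) : Prop :=
  ∃ M : Mechanism T, M.Implements D π

/-- The set of feasible reduced forms. -/
def feasibleSet (D : Measure (∀ i, T i)) : Set (∀ i, T i → ℝ) :=
  {π | IsReducedForm π ∧ Feasible D π}

/-- The virtual reduced form `π̂ᵢ(A) = Pr[πᵢ(tᵢ) ≤ πᵢ(A)] · πᵢ(A)`. -/
noncomputable def virtualForm (D : Measure (∀ i, T i)) (π : ∀ i, T i → ℝ)
    (i : Fin m) (A : T i) : ℝ :=
  D.real {t | π i (t i) ≤ π i A} * π i A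

/-- The sets `{A ∈ Tᵢ | π̂ᵢ(A) > x}`, for one threshold `x` common to all bidders. -/
def virtualUpperSet (D : Measure (∀ i, T i)) (π : ∀ i, T i → ℝ) (x : ℝ) (i : Fin m) :
    Set (T i) :=
  {A | virtualForm D π i A > x}

variable [∀ i, Fintype (T i)]

open scoped Classical in
/-- Border's inequality for the sets `S i ⊆ T i`:
`∑ᵢ ∑_{A ∈ Sᵢ} πᵢ(A) Pr[tᵢ = A] ≤ 1 - ∏ᵢ (1 - Pr[tᵢ ∈ Sᵢ])`. -/
def BorderInequality (D : Measure (∀ i, T i)) (π : ∀ i, T i → ℝ) (S : ∀ i, Set (T i)) : Prop :=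
  ∑ i, ∑ A with A ∈ S i, π i A * D.real {t | t i = A}
    ≤ 1 - ∏ i, (1 - D.real {t | t i ∈ S i})

end Forms

end Auction

/-! ## The real RAM

A real random access machine, programmed in a structured language. Memory consists of registers
and of unbounded arrays, each holding either natural numbers (used for counting, addressing and
control) or real numbers. Every arithmetic operation, memory access, comparison and assignment
costs one unit of time. There is no rounding and no conversion of reals into naturals, and the
only real constants a program may contain are rational numbers. -/

namespace RealRAM

/-- The memory: registers `nvar x`, `rvar x` and array cells `narr a j`, `rarr a j`. -/
@[ext]
structure State where
  nvar : ℕ → ℕ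
  rvar : ℕ → ℝ
  narr : ℕ → ℕ → ℕ
  rarr : ℕ → ℕ → ℝ

/-- Expressions with values in the natural numbers (`sub` is truncated). -/
inductive NExpr where
  | const (n : ℕ)
  | var (x : ℕ)
  | read (a : ℕ) (j : NExpr)
  | add (e f : NExpr)
  | sub (e f : NExpr)

/-- Expressions with real values. -/
inductive RExpr where
  | const (q : ℚ)
  | var (x : ℕ)
  | read (a : ℕ) (j : NExpr)
  | add (e f : RExpr)
  | sub (e f : RExpr)
  | mul (e f : RExpr)
  | div (e f : RExpr)

/-- Tests. -/
inductive Test where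
  | nle (e f : NExpr)
  | rle (e f : RExpr)
  | not (b : Test)
  | and (b c : Test)

/-- Programs. -/
inductive Cmd where
  | skip
  | setN (x : ℕ) (e : NExpr)
  | setR (x : ℕ) (e : RExpr)
  | writeN (a : ℕ) (j : NExpr) (e : NExpr)
  | writeR (a : ℕ) (j : NExpr) (e : RExpr)
  | seq (c d : Cmd)
  | ite (b : Test) (c d : Cmd)
  | loop (b : Test) (c : Cmd)

def NExpr.eval (s : State) : NExpr → ℕ
  | const n => n
  | var x => s.nvar x
  | read a j => s.narr a (j.eval s)
  | add e f => e.eval s + f.eval s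
  | sub e f => e.eval s - f.eval s

def NExpr.cost : NExpr → ℕ
  | const _ => 1
  | var _ => 1
  | read _ j => j.cost + 1
  | add e f => e.cost + f.cost + 1
  | sub e f => e.cost + f.cost + 1

noncomputable def RExpr.eval (s : State) : RExpr → ℝ
  | const q => (q : ℝ)
  | var x => s.rvar x
  | read a j => s.rarr a (j.eval s)
  | add e f => e.eval s + f.eval s
  | sub e f => e.eval s - f.eval s
  | mul e f => e.eval s * f.eval s
  | div e f => e.eval s / f.eval s

def RExpr.cost : RExpr → ℕ
  | const _ => 1
  | var _ => 1
  | read _ j => j.cost + 1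
  | add e f => e.cost + f.cost + 1
  | sub e f => e.cost + f.cost + 1
  | mul e f => e.cost + f.cost + 1
  | div e f => e.cost + f.cost + 1

def Test.Holds (s : State) : Test → Prop
  | nle e f => e.eval s ≤ f.eval s
  | rle e f => e.eval s ≤ f.eval s
  | not b => ¬ b.Holds s
  | and b c => b.Holds s ∧ c.Holds s

def Test.cost : Test → ℕ
  | nle e f => e.cost + f.cost + 1
  | rle e f => e.cost + f.cost + 1
  | not b => b.cost + 1
  | and b c => b.cost + c.cost + 1

/-- `Exec c s s' k`: started in memory `s`, the program `c` halts in memory `s'` after exactly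
`k` units of time. The relation is deterministic. -/
inductive Exec : Cmd → State → State → ℕ → Prop where
  | skip (s : State) : Exec Cmd.skip s s 1
  | setN (s : State) (x : ℕ) (e : NExpr) :
      Exec (Cmd.setN x e) s
        { s with nvar := Function.update s.nvar x (e.eval s) } (e.cost + 1)
  | setR (s : State) (x : ℕ) (e : RExpr) :
      Exec (Cmd.setR x e) s
        { s with rvar := Function.update s.rvar x (e.eval s) } (e.cost + 1)
  | writeN (s : State) (a : ℕ) (j e : NExpr) :
      Exec (Cmd.writeN a j e) s
        { s with narr := Function.update s.narr a
                        (Function.update (s.narr a) (j.eval s) (e.eval s)) } (j.cost + e.cost + 1)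
  | writeR (s : State) (a : ℕ) (j : NExpr) (e : RExpr) :
      Exec (Cmd.writeR a j e) s
        { s with rarr := Function.update s.rarr a
                        (Function.update (s.rarr a) (j.eval s) (e.eval s)) } (j.cost + e.cost + 1)
  | seq {c d : Cmd} {s s₁ s₂ : State} {k l : ℕ} :
      Exec c s s₁ k → Exec d s₁ s₂ l → Exec (Cmd.seq c d) s s₂ (k + l)
  | iteTrue {b : Test} {c d : Cmd} {s s₁ : State} {k : ℕ} :
      b.Holds s → Exec c s s₁ k → Exec (Cmd.ite b c d) s s₁ (b.cost + k)
  | iteFalse {b : Test} {c d : Cmd} {s s₁ : State} {k : ℕ} :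
      ¬ b.Holds s → Exec d s s₁ k → Exec (Cmd.ite b c d) s s₁ (b.cost + k)
  | loopTrue {b : Test} {c : Cmd} {s s₁ s₂ : State} {k l : ℕ} :
      b.Holds s → Exec c s s₁ k → Exec (Cmd.loop b c) s₁ s₂ l →
      Exec (Cmd.loop b c) s s₂ (b.cost + k + l)
  | loopFalse {b : Test} {c : Cmd} {s : State} :
      ¬ b.Holds s → Exec (Cmd.loop b c) s s b.cost

end RealRAM

namespace Auction

section Algorithm

variable {m : ℕ} {T : Fin m → Type u} [∀ i, MeasurableSpace (T i)]

/-- The input memory. The `N = ∑ i, |T i|` pairs of a bidder and one of her types are listed in an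
arbitrary order `e`. Register `0` holds `N` and register `1` holds `m`. For the `j`-th listed pair
`(i, A)`, the cell `j` of natural-number array `0` holds the bidder `i`, and the cells `j` of the
real arrays `0` and `1` hold `πᵢ(A)` and `Pr[tᵢ = A]`. The rest of the memory is zero. -/
noncomputable def inputState {N : ℕ} (e : (Σ i, T i) ≃ Fin N) (D : Measure (∀ i, T i))
    (π : ∀ i, T i → ℝ) : RealRAM.State where
  nvar x := if x = 0 then N else if x = 1 then m else 0
  rvar _ := 0
  narr a j := if h : j < N then (if a = 0 then ((e.symm ⟨j, h⟩).1 : ℕ) else 0) else 0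
  rarr a j :=
    if h : j < N then
      (if a = 0 then π (e.symm ⟨j, h⟩).1 (e.symm ⟨j, h⟩).2
       else if a = 1 then D.real {t | t (e.symm ⟨j, h⟩).1 = (e.symm ⟨j, h⟩).2}
       else 0)
    else 0

/-- The output memory `s` is a correct answer: either register `2` holds `1` and `π` is feasible,
or register `2` holds `0`, `π` is infeasible, and a hyperplane separating `π` from the set of
feasible reduced forms has been written out: its offset in real register `0` and its normal vector
in real array `2`, in the order `e` of the input. -/
def CorrectOutput [∀ i, Fintype (T i)] {N : ℕ} (e : (Σ i, T i) ≃ Fin N)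
    (D : Measure (∀ i, T i)) (π : ∀ i, T i → ℝ) (s : RealRAM.State) : Prop :=
  (s.nvar 2 = 1 ∧ Feasible D π) ∨
  (s.nvar 2 = 0 ∧ ¬ Feasible D π ∧
    Separates (fun i A => s.rarr 2 (e ⟨i, A⟩)) (s.rvar 0) π (feasibleSet D))

end Algorithm

end Auction

/-!
**Border's inequalities.** Feasibility of `π` is a transportation problem: the probability of every
type profile has to be divided among the types that occur in it so that type `A` of bidder `i`
receives `πᵢ(A) Pr[tᵢ = A]`. A fractional form of Hall's theorem (`exists_fractional_assignment`,
from the separation of convex sets and a layer-cake decomposition of the separating weights) turns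
this into Border's inequalities for all families of sets `Sᵢ`, because by independence some `tᵢ`
lies in `Sᵢ` with probability `1 - ∏ᵢ (1 - Pr[tᵢ ∈ Sᵢ])`. This gives `Feasible.borderInequality`
and `feasible_of_borderInequality`.

**Few inequalities suffice.** Take a family `S` that violates Border's inequality most and is as
small as possible. Removing or adding one type `A` of bidder `i` changes the excess by
`Pr[tᵢ = A] (πᵢ(A) - cᵢ)`, where `cᵢ = ∏_{j ≠ i} (1 - Pr[tⱼ ∈ Sⱼ])`, so that `Sᵢ` is
`{A | πᵢ(A) > cᵢ}` up to null types. For `A` of positive probability, the types not above `A` have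
probability more than `1 - Pr[tᵢ ∈ Sᵢ]` if `A ∈ Sᵢ` and at most that otherwise, and `(1 - Pr[tᵢ ∈ Sᵢ]) cᵢ` does not
depend on `i`. Hence `S` is a family of upper sets of the virtual reduced form, with one threshold
for all bidders (`exists_threshold_borderExcess_ge`). Ties in `πᵢ` may be broken arbitrarily in
the definition of the virtual form; the program makes use of this.

**The program.** Merge sort by `π` yields the virtual form (with ties broken by the sorted order)
as a cumulative sum for each bidder. A second merge sort, by the virtual form, makes every family
of upper sets a prefix of the sorted list, and Border's inequality is evaluated for all `N`
prefixes, at `m` multiplications each. A violated inequality is itself a separating hyperplane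
(`separates_of_borderExcess_pos`). Programs are verified by loop invariants together with a bound
on the number of iterations (`Runs.loop`); the numerical time bounds are generous.
-/

namespace Auction

/-! ### A fractional form of Hall's theorem -/

section Gale

open scoped Classical

variable {Ω J : Type*} [Fintype Ω] [Fintype J]

/-- The layer-cake step: demands that satisfy Hall's condition for all sets satisfy it for all
nonnegative weights `w`, where `M` dominates the largest weight that can be served at `ω`. A
uniform layer is peeled off the support of `w`. -/
theorem sum_mul_le_of_hall {P : Ω → ℝ} {R : Ω → J → Prop} {d : J → ℝ}
    (h : ∀ S : Finset J, ∑ j ∈ S, d j ≤ ∑ ω with ∃ j ∈ S, R ω j, P ω)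
    (hP : ∀ ω, 0 ≤ P ω) (w : J → ℝ) (hw : ∀ j, 0 ≤ w j) (M : Ω → ℝ) (hM0 : ∀ ω, 0 ≤ M ω)
    (hM : ∀ ω j, R ω j → w j ≤ M ω) :
    ∑ j, w j * d j ≤ ∑ ω, P ω * M ω := by
  induction hn : (Finset.univ.filter fun j => w j ≠ 0).card using Nat.strong_induction_on
    generalizing w M with
  | _ n ih =>
    set S := Finset.univ.filter fun j => w j ≠ 0 with hS
    rcases S.eq_empty_or_nonempty with h0 | hne
    · have hw0 : ∀ j, w j = 0 := by
        intro j
        by_contra hj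
        have : j ∈ S := by simp [hS, hj]
        simp [h0] at this
      simp only [hw0, zero_mul, Finset.sum_const_zero]
      exact Finset.sum_nonneg fun ω _ => mul_nonneg (hP ω) (hM0 ω)
    · obtain ⟨j₀, hj₀, hmin⟩ := S.exists_min_image w hne
      set ε := w j₀ with hε
      have hεpos : 0 < ε := lt_of_le_of_ne (hw j₀) (Ne.symm (by simpa [hS] using hj₀))
      have key := ih (Finset.univ.filter fun j => w j - (if j ∈ S then ε else 0) ≠ 0).card
        (by
          rw [← hn]
          refine Finset.card_lt_card ⟨?_, ?_⟩
          · intro j hj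
            by_contra hjS
            have hwj : w j = 0 := by simpa [hS] using hjS
            simp [hjS, hwj] at hj
          · intro hsub
            have := hsub hj₀
            simp [hj₀, hε] at this)
        (fun j => w j - (if j ∈ S then ε else 0))
        (by
          intro j
          by_cases hj : j ∈ S
          · simpa [hj] using hmin j hj
          · simpa [hj] using hw j)
        (fun ω => M ω - (if ∃ j ∈ S, R ω j then ε else 0))
        (by
          intro ω
          by_cases hω : ∃ j ∈ S, R ω j
          · obtain ⟨j, hj, hr⟩ := hω
            have := (hmin j hj).trans (hM ω j hr)
            simp only [if_pos (show ∃ j ∈ S, R ω j from ⟨j, hj, hr⟩)]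
            linarith
          · simpa [hω] using hM0 ω)
        (by
          intro ω j hr
          by_cases hj : j ∈ S
          · simp only [if_pos (show ∃ j ∈ S, R ω j from ⟨j, hj, hr⟩), if_pos hj]
            linarith [hM ω j hr]
          · have hwj : w j = 0 := by simpa [hS] using hj
            by_cases hω : ∃ j ∈ S, R ω j
            · obtain ⟨j', hj', hr'⟩ := hω
              have := (hmin j' hj').trans (hM ω j' hr')
              simp only [if_pos (show ∃ j ∈ S, R ω j from ⟨j', hj', hr'⟩), if_neg hj]
              linarith
            · simpa [hω, hj] using hM ω j hr)
        rfl
      have hlayer := mul_le_mul_of_nonneg_left (h S) hεpos.le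
      have e1 : ∑ j, w j * d j
          = ∑ j, (w j - if j ∈ S then ε else 0) * d j + ε * ∑ j ∈ S, d j := by
        have hS' : ∑ j ∈ S, ε * d j = ∑ j, if j ∈ S then ε * d j else 0 := by simp
        rw [Finset.mul_sum, hS', ← Finset.sum_add_distrib]
        refine Finset.sum_congr rfl fun j _ => ?_
        split_ifs <;> ring
      have e2 : ∑ ω, P ω * M ω
          = ∑ ω, P ω * (M ω - if ∃ j ∈ S, R ω j then ε else 0)
            + ε * ∑ ω with ∃ j ∈ S, R ω j, P ω := by
        rw [Finset.mul_sum, Finset.sum_filter, ← Finset.sum_add_distrib]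
        refine Finset.sum_congr rfl fun ω _ => ?_
        split_ifs <;> ring
      rw [e1, e2]
      exact add_le_add key hlayer

/-- Fractional Hall theorem (Gale's supply and demand theorem): if the demand of every set `S` is
at most the total supply `P` of the points that can serve some member of `S`, then the supplies
can be divided so that all demands are met. -/
theorem exists_fractional_assignment {P : Ω → ℝ} {R : Ω → J → Prop} {d : J → ℝ}
    (h : ∀ S : Finset J, ∑ j ∈ S, d j ≤ ∑ ω with ∃ j ∈ S, R ω j, P ω) (hP : ∀ ω, 0 ≤ P ω) :
    ∃ φ : Ω → J → ℝ, (∀ ω j, 0 ≤ φ ω j) ∧ (∀ ω, ∑ j, φ ω j ≤ 1) ∧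
      (∀ ω j, ¬ R ω j → φ ω j = 0) ∧ ∀ j, d j ≤ ∑ ω, P ω * φ ω j := by
  by_contra hcon
  push Not at hcon
  let Φ : Set (Ω → J → ℝ) :=
    {φ | (∀ ω j, 0 ≤ φ ω j) ∧ (∀ ω, ∑ j, φ ω j ≤ 1) ∧ (∀ ω j, ¬ R ω j → φ ω j = 0)}
  let L : (Ω → J → ℝ) →ₗ[ℝ] (J → ℝ) :=
    { toFun := fun φ j => ∑ ω, P ω * φ ω j
      map_add' := by
        intro a b; ext j
        simp [mul_add, Finset.sum_add_distrib]
      map_smul' := by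
        intro c a; ext j
        simp only [Pi.smul_apply, smul_eq_mul, RingHom.id_apply, Finset.mul_sum]
        exact Finset.sum_congr rfl fun ω _ => by ring }
  have hLcont : Continuous L := L.continuous_of_finiteDimensional
  have hΦclosed : IsClosed Φ := by
    have : Φ = (⋂ ω, ⋂ j, {φ | 0 ≤ φ ω j}) ∩ ((⋂ ω, {φ | ∑ j, φ ω j ≤ 1}) ∩
        ⋂ ω, ⋂ j, ⋂ _ : ¬ R ω j, {φ | φ ω j = 0}) := by
      ext φ; simp [Φ]
    rw [this]
    refine IsClosed.inter (isClosed_iInter fun ω => isClosed_iInter fun j =>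
      isClosed_le (by fun_prop) (by fun_prop)) (IsClosed.inter (isClosed_iInter fun ω =>
      isClosed_le (by fun_prop) (by fun_prop)) (isClosed_iInter fun ω => isClosed_iInter fun j =>
      isClosed_iInter fun _ => isClosed_eq (by fun_prop) (by fun_prop)))
  have hΦcompact : IsCompact Φ := by
    refine IsCompact.of_isClosed_subset (isCompact_Icc (a := (0 : Ω → J → ℝ)) (b := 1))
      hΦclosed fun φ hφ => ⟨fun ω j => hφ.1 ω j, fun ω j => ?_⟩
    exact (Finset.single_le_sum (fun j' _ => hφ.1 ω j') (Finset.mem_univ j)).trans (hφ.2.1 ω)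
  have hΦconvex : Convex ℝ Φ := by
    intro x hx y hy a b ha hb hab
    refine ⟨fun ω j => ?_, fun ω => ?_, fun ω j hr => ?_⟩
    · simpa using add_nonneg (mul_nonneg ha (hx.1 ω j)) (mul_nonneg hb (hy.1 ω j))
    · simp only [Pi.add_apply, Pi.smul_apply, smul_eq_mul, Finset.sum_add_distrib,
        ← Finset.mul_sum]
      nlinarith [mul_le_mul_of_nonneg_left (hx.2.1 ω) ha, mul_le_mul_of_nonneg_left (hy.2.1 ω) hb]
    · simp [hx.2.2 ω j hr, hy.2.2 ω j hr]
  have hdisj : Disjoint (L '' Φ) (Set.Ici d) := by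
    rw [Set.disjoint_left]
    rintro _ ⟨φ, hφ, rfl⟩ hd
    obtain ⟨j, hj⟩ := hcon φ hφ.1 hφ.2.1 hφ.2.2
    exact absurd (hd j) (not_le.mpr hj)
  obtain ⟨f, u, v, hu, huv, hv⟩ := geometric_hahn_banach_compact_closed
    (hΦconvex.linear_image L) (hΦcompact.image hLcont) (convex_Ici d) isClosed_Ici hdisj
  set w : J → ℝ := fun j => f (Pi.single j 1) with hw
  have hf : ∀ y : J → ℝ, f y = ∑ j, w j * y j := by
    intro y
    have := LinearMap.pi_apply_eq_sum_univ f.toLinearMap y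
    simp only [ContinuousLinearMap.coe_coe, smul_eq_mul] at this
    rw [this]
    refine Finset.sum_congr rfl fun j _ => ?_
    rw [mul_comm, hw]
    congr 2
    ext k
    simp [Pi.single_apply, eq_comm]
  have hw0 : ∀ j, 0 ≤ w j := by
    intro j
    by_contra! hj
    have h1 : v < f d := hv d (Set.mem_Ici.mpr le_rfl)
    have hc : 0 ≤ (f d - v) / (-w j) := div_nonneg (by linarith) (by linarith)
    have h2 := hv (d + ((f d - v) / (-w j)) • Pi.single j (1 : ℝ)) (by
      rw [Set.mem_Ici]
      exact le_add_of_nonneg_right (smul_nonneg hc (Pi.single_nonneg.mpr zero_le_one)))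
    rw [map_add, map_smul, smul_eq_mul] at h2
    change v < f d + (f d - v) / (-w j) * w j at h2
    have h3 : (f d - v) / (-w j) * w j = -(f d - v) := by
      rw [div_mul_eq_mul_div, div_eq_iff (by linarith)]
      ring
    linarith
  -- serving, at every point, an admissible `j` of largest weight is the best response to `w`
  have hgreedy : ∀ ω, ∃ ψ : J → ℝ, (∀ j, 0 ≤ ψ j) ∧ ∑ j, ψ j ≤ 1 ∧ (∀ j, ¬ R ω j → ψ j = 0) ∧
      ∀ j, R ω j → w j ≤ ∑ j, w j * ψ j := by
    intro ω
    by_cases hω : (Finset.univ.filter fun j => R ω j).Nonempty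
    · obtain ⟨j₀, hj₀, hmax⟩ := Finset.exists_max_image _ w hω
      have hr₀ : R ω j₀ := by simpa using hj₀
      refine ⟨Pi.single j₀ 1, fun j => ?_, by simp, fun j hr => ?_, fun j hr => ?_⟩
      · rw [Pi.single_apply]; split_ifs <;> norm_num
      · have : j ≠ j₀ := by rintro rfl; exact hr hr₀
        simp [this]
      · simpa [Pi.single_apply] using hmax j (by simpa using hr)
    · refine ⟨0, by simp, by simp, by simp, fun j hr => ?_⟩
      exact absurd ⟨j, by simpa using hr⟩ hω
  choose φ hφ0 hφ1 hφR hφw using hgreedy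
  have h1 := hu (L φ) ⟨φ, ⟨hφ0, hφ1, hφR⟩, rfl⟩
  have h2 := hv d (Set.mem_Ici.mpr le_rfl)
  have h3 := sum_mul_le_of_hall h hP w hw0 (fun ω => ∑ j, w j * φ ω j)
    (fun ω => Finset.sum_nonneg fun j _ => mul_nonneg (hw0 j) (hφ0 ω j)) hφw
  have h4 : ∑ j, w j * L φ j = ∑ ω, P ω * ∑ j, w j * φ ω j := by
    change ∑ j, w j * ∑ ω, P ω * φ ω j = _
    simp only [Finset.mul_sum]
    rw [Finset.sum_comm]
    exact Finset.sum_congr rfl fun ω _ => Finset.sum_congr rfl fun j _ => by ring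
  rw [hf] at h1 h2
  linarith

end Gale

end Auction

namespace Auction

/-! ### The most violated Border inequality -/

section Thresholds

open scoped Classical

variable {m : ℕ} {T : Fin m → Type u}

/-- The amount by which Border's inequality for the sets `S i` is violated, when bidder `i` has
type `A` with probability `p i A`. -/
noncomputable def borderExcess (p π : ∀ i, T i → ℝ) (S : ∀ i, Finset (T i)) : ℝ :=
  ∑ i, ∑ A ∈ S i, π i A * p i A - (1 - ∏ i, (1 - ∑ A ∈ S i, p i A))

/-- As a function of the set of one bidder alone, the excess is additive. -/
theorem borderExcess_update (p π : ∀ i, T i → ℝ) (S : ∀ i, Finset (T i)) (i : Fin m)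
    (U : Finset (T i)) :
    borderExcess p π (Function.update S i U) = borderExcess p π S
      + ∑ A ∈ U, p i A * (π i A - ∏ j ∈ Finset.univ.erase i, (1 - ∑ B ∈ S j, p j B))
      - ∑ A ∈ S i, p i A * (π i A - ∏ j ∈ Finset.univ.erase i, (1 - ∑ B ∈ S j, p j B)) := by
  have hs : ∀ V : ∀ i, Finset (T i), (∀ j, j ≠ i → V j = S j) →
      borderExcess p π V
        = ∑ A ∈ V i, p i A * (π i A - ∏ j ∈ Finset.univ.erase i, (1 - ∑ B ∈ S j, p j B))
          + (∑ j ∈ Finset.univ.erase i, ∑ A ∈ S j, π j A * p j A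
            + ∏ j ∈ Finset.univ.erase i, (1 - ∑ B ∈ S j, p j B) - 1) := by
    intro V hV
    unfold borderExcess
    rw [← Finset.add_sum_erase _ _ (Finset.mem_univ i),
      ← Finset.mul_prod_erase _ _ (Finset.mem_univ i)]
    have h1 : ∀ j ∈ Finset.univ.erase i, V j = S j := fun j hj => hV j (Finset.ne_of_mem_erase hj)
    have h2 : ∑ j ∈ Finset.univ.erase i, ∑ A ∈ V j, π j A * p j A
        = ∑ j ∈ Finset.univ.erase i, ∑ A ∈ S j, π j A * p j A :=
      Finset.sum_congr rfl fun j hj => by rw [h1 j hj]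
    have h3 : ∏ j ∈ Finset.univ.erase i, (1 - ∑ B ∈ V j, p j B)
        = ∏ j ∈ Finset.univ.erase i, (1 - ∑ B ∈ S j, p j B) :=
      Finset.prod_congr rfl fun j hj => by rw [h1 j hj]
    rw [h2, h3]
    simp only [mul_sub, Finset.sum_sub_distrib, ← Finset.sum_mul]
    rw [Finset.sum_congr rfl fun A _ => mul_comm (p i A) (π i A)]
    ring
  rw [hs _ fun j hj => Function.update_of_ne hj _ _, hs S fun _ _ => rfl, Function.update_self]
  ring

variable [∀ i, Fintype (T i)]

/-- Sets that agree up to types of probability zero have the same excess. -/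
theorem borderExcess_congr {p π : ∀ i, T i → ℝ} {S U : ∀ i, Finset (T i)}
    (h : ∀ i A, p i A ≠ 0 → (A ∈ S i ↔ A ∈ U i)) :
    borderExcess p π S = borderExcess p π U := by
  have key : ∀ i (f : T i → ℝ), (∀ A, p i A = 0 → f A = 0) →
      ∑ A ∈ S i, f A = ∑ A ∈ U i, f A := by
    intro i f hf
    rw [← Finset.univ_inter (S i), ← Finset.univ_inter (U i), ← Finset.sum_ite_mem,
      ← Finset.sum_ite_mem]
    refine Finset.sum_congr rfl fun A _ => ?_
    by_cases hA : p i A = 0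
    · simp [hf A hA]
    · simp only [h i A hA]
  unfold borderExcess
  simp only [key _ _ fun A hA => hA]
  congr 1
  exact Finset.sum_congr rfl fun i _ => key i _ fun A hA => by simp [hA]

/-- Some most violated Border inequality has sets of the form `{A | x < gᵢ(A) πᵢ(A)}`, where
`gᵢ(A)` is the probability of a lower set of types between `{B | πᵢ(B) < πᵢ(A)} ∪ {A}` and
`{B | πᵢ(B) ≤ πᵢ(A)}`. For a smallest maximizer `S` of the excess, `A ∈ Sᵢ` exactly when `πᵢ(A)`
exceeds the probability `cᵢ` that no other bidder is in her set; since `(1 - Pr[tᵢ ∈ Sᵢ]) cᵢ` is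
the same for all `i`, it serves as a common threshold `x`. -/
theorem exists_threshold_borderExcess_ge {p π g : ∀ i, T i → ℝ} (hp : ∀ i A, 0 ≤ p i A)
    (hp1 : ∀ i, ∑ A, p i A = 1) (hπ : ∀ i A, 0 ≤ π i A)
    (hg_lower : ∀ i A, ∑ B with π i B < π i A, p i B + p i A ≤ g i A)
    (hg_upper : ∀ i A, g i A ≤ ∑ B with π i B ≤ π i A, p i B) (S₀ : ∀ i, Finset (T i)) :
    ∃ x : ℝ, borderExcess p π S₀
      ≤ borderExcess p π fun i => Finset.univ.filter fun A => x < g i A * π i A := by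
  obtain ⟨S₁, -, hS₁⟩ := Finset.exists_max_image (Finset.univ : Finset (∀ i, Finset (T i)))
    (borderExcess p π) ⟨S₀, Finset.mem_univ _⟩
  obtain ⟨S, hS, hmin⟩ := Finset.exists_min_image
    (Finset.univ.filter fun S => borderExcess p π S₁ ≤ borderExcess p π S)
    (fun S => ∑ i, (S i).card) ⟨S₁, by simp⟩
  have hSS₁ : borderExcess p π S₁ ≤ borderExcess p π S := by simpa using hS
  have hSmax : ∀ U, borderExcess p π U ≤ borderExcess p π S := fun U =>
    (hS₁ U (Finset.mem_univ _)).trans hSS₁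
  set q : Fin m → ℝ := fun i => 1 - ∑ A ∈ S i, p i A with hq
  set c : Fin m → ℝ := fun i => ∏ j ∈ Finset.univ.erase i, q j with hc
  have hq0 : ∀ i, 0 ≤ q i := fun i => by
    have := Finset.sum_le_sum_of_subset_of_nonneg (Finset.subset_univ (S i))
      fun A _ _ => hp i A
    rw [hp1] at this
    simp only [hq]
    linarith
  have hc0 : ∀ i, 0 ≤ c i := fun i => Finset.prod_nonneg fun j _ => hq0 j
  have hin : ∀ i, ∀ A ∈ S i, 0 < p i A ∧ c i < π i A := by
    intro i A hA
    have hlt : borderExcess p π (Function.update S i ((S i).erase A)) < borderExcess p π S := by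
      by_contra! hle
      have h1 := hmin (Function.update S i ((S i).erase A))
        (by simpa using hSS₁.trans hle)
      have h2 : ∑ j, (Function.update S i ((S i).erase A) j).card < ∑ j, (S j).card := by
        refine Finset.sum_lt_sum (fun j _ => ?_) ⟨i, Finset.mem_univ i, ?_⟩
        · by_cases hj : j = i
          · subst hj; simpa using Finset.card_le_card (Finset.erase_subset A (S j))
          · simp [hj]
        · simpa using Finset.card_lt_card (Finset.erase_ssubset hA)
      omega
    rw [borderExcess_update, ← Finset.add_sum_erase _ _ hA] at hlt
    have h3 : 0 < p i A * (π i A - c i) := by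
      simp only [hc, hq]
      linarith
    have h4 : 0 < p i A := lt_of_le_of_ne (hp i A) fun h => by simp [← h] at h3
    exact ⟨h4, sub_pos.mp (pos_of_mul_pos_right h3 h4.le)⟩
  have hout : ∀ i A, A ∉ S i → 0 < p i A → π i A ≤ c i := by
    intro i A hA hpA
    have hle := hSmax (Function.update S i (insert A (S i)))
    rw [borderExcess_update, Finset.sum_insert hA] at hle
    have h3 : p i A * (π i A - c i) ≤ 0 := by
      simp only [hc, hq]
      linarith
    by_contra! hlt
    linarith [mul_pos hpA (sub_pos.mpr hlt)]
  have hqc : ∀ i, q i * c i = ∏ j, q j := fun i =>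
    Finset.mul_prod_erase _ _ (Finset.mem_univ i)
  have hq' : ∀ i, q i = ∑ A ∈ Finset.univ \ S i, p i A := fun i => by
    have := Finset.sum_sdiff (f := p i) (Finset.subset_univ (S i))
    rw [hp1] at this
    simp only [hq]
    linarith
  refine ⟨∏ j, q j, (hSmax S₀).trans (le_of_eq (borderExcess_congr fun i A hpA => ?_))⟩
  have hpA' : 0 < p i A := lt_of_le_of_ne (hp i A) (Ne.symm hpA)
  rw [Finset.mem_filter, ← hqc i]
  constructor
  · intro hA
    refine ⟨Finset.mem_univ A, ?_⟩
    have hcA := (hin i A hA).2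
    -- every type of positive probability outside `Sᵢ` lies strictly below `A`
    have h1 : q i ≤ ∑ B with π i B < π i A, p i B := by
      rw [hq', ← Finset.sum_filter_ne_zero]
      refine Finset.sum_le_sum_of_subset_of_nonneg (fun B hB => ?_) fun B _ _ => hp i B
      simp only [Finset.mem_filter, Finset.mem_sdiff, Finset.mem_univ, true_and] at hB ⊢
      exact (hout i B hB.1 (lt_of_le_of_ne (hp i B) (Ne.symm hB.2))).trans_lt hcA
    have h2 : q i + p i A ≤ g i A := by linarith [hg_lower i A]
    calc q i * c i ≤ q i * π i A := mul_le_mul_of_nonneg_left hcA.le (hq0 i)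
      _ < (q i + p i A) * π i A := by
        have := mul_pos hpA' ((hc0 i).trans_lt hcA)
        linarith
      _ ≤ g i A * π i A := mul_le_mul_of_nonneg_right h2 (hπ i A)
  · rintro ⟨-, hlt⟩
    by_contra hA
    have hcA := hout i A hA hpA'
    have h1 : g i A ≤ q i := by
      refine (hg_upper i A).trans ?_
      rw [hq']
      refine Finset.sum_le_sum_of_subset_of_nonneg (fun B hB => ?_) fun B _ _ => hp i B
      simp only [Finset.mem_filter, Finset.mem_sdiff, Finset.mem_univ, true_and] at hB ⊢
      exact fun hBS => absurd (hB.trans hcA) (not_le.mpr (hin i B hBS).2)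
    have h2 := mul_le_mul h1 hcA (hπ i A) (hq0 i)
    linarith

end Thresholds

end Auction

namespace Auction

/-! ### Border's theorem -/

section Border

open scoped Classical

variable {m : ℕ} {T : Fin m → Type u} [∀ i, MeasurableSpace (T i)]

/-- The probability `Pr[tᵢ = A]`. -/
noncomputable abbrev typeProb (D : Measure (∀ i, T i)) (i : Fin m) (A : T i) : ℝ :=
  D.real {t | t i = A}

variable [∀ i, Fintype (T i)] [∀ i, MeasurableSingletonClass (T i)]
  {D : Measure (∀ i, T i)}

/-- Since the interim allocation of type `A` does not depend on the type of bidder `i`, its product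
with `Pr[tᵢ = A]` is the probability that bidder `i` has type `A` and receives the item. -/
theorem typeProb_mul_interim (hD : iIndepFun (fun (i : Fin m) (t : ∀ j, T j) => t i) D)
    (M : Mechanism T) (i : Fin m) (A : T i) :
    typeProb D i A * M.interim D i A = ∫ t, (if t i = A then M.alloc t i else 0) ∂D := by
  have hind := hD.indepFun_finset {i} (Finset.univ.erase i)
    (by simp) fun i => measurable_pi_apply i
  -- the report `update t i A` is a function of the coordinates other than `i`
  have hcomp := hind.comp (φ := fun x => if x ⟨i, by simp⟩ = A then (1 : ℝ) else 0)
    (ψ := fun y => M.alloc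
      (fun j => if h : j = i then h ▸ A else y ⟨j, by simp [h]⟩) i)
    .of_discrete .of_discrete
  have hupd : ∀ t : ∀ i, T i, (fun j => if h : j = i then h ▸ A else t j)
      = Function.update t i A := by
    intro t
    funext j
    by_cases h : j = i
    · subst h; simp
    · simp [h]
  have hmul := hcomp.integral_fun_mul_eq_mul_integral
    (Measurable.of_discrete.aestronglyMeasurable) (Measurable.of_discrete.aestronglyMeasurable)
  simp only [Function.comp_def, hupd] at hmul
  have h1 : ∫ t, (if t i = A then (1 : ℝ) else 0) ∂D = typeProb D i A := by
    refine (integral_congr_ae (.of_forall fun t => ?_)).trans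
      (integral_indicator_one (s := {t : ∀ j, T j | t i = A}) .of_discrete)
    simp [Set.indicator_apply]
  rw [← h1, Mechanism.interim, ← hmul]
  refine integral_congr_ae (.of_forall fun t => ?_)
  by_cases h : t i = A
  · subst h; simp
  · simp [h]

variable [IsProbabilityMeasure D]

theorem measureReal_mem_eq_sum (i : Fin m) (S : Finset (T i)) :
    D.real {t | t i ∈ S} = ∑ A ∈ S, typeProb D i A := by
  have h : ({t | t i ∈ S} : Set (∀ i, T i)) = ⋃ A ∈ S, {t | t i = A} := by
    ext t; simp
  rw [h, measureReal_biUnion_finset]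
  · intro A _ B _ hAB
    exact Set.disjoint_left.mpr fun t hA hB => hAB (hA.symm.trans hB)
  · exact fun A _ => .of_discrete

theorem sum_typeProb (i : Fin m) : ∑ A, typeProb D i A = 1 := by
  rw [← measureReal_mem_eq_sum i Finset.univ]
  simp

theorem measureReal_exists_mem (hD : iIndepFun (fun (i : Fin m) (t : ∀ j, T j) => t i) D)
    (S : ∀ i, Set (T i)) :
    D.real {t | ∃ i, t i ∈ S i} = 1 - ∏ i, (1 - D.real {t | t i ∈ S i}) := by
  have h := hD.meas_iInter (s := fun i => {t | t i ∉ S i})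
    fun i => ⟨(S i)ᶜ, .of_discrete, rfl⟩
  have h1 : D.real {t | ∃ i, t i ∈ S i} = 1 - D.real (⋂ i, {t | t i ∉ S i}) := by
    rw [← probReal_compl_eq_one_sub .of_discrete]
    congr 1
    ext t; simp
  rw [h1, measureReal_def, h, ENNReal.toReal_prod]
  congr 1
  refine Finset.prod_congr rfl fun i _ => ?_
  rw [← probReal_compl_eq_one_sub .of_discrete]
  rfl

theorem borderInequality_iff_borderExcess {π : ∀ i, T i → ℝ} {S : ∀ i, Set (T i)} :
    BorderInequality D π S
      ↔ borderExcess (typeProb D) π (fun i => Finset.univ.filter fun A => A ∈ S i) ≤ 0 := by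
  have h : ∀ i, D.real {t | t i ∈ S i} = ∑ A with A ∈ S i, typeProb D i A := by
    intro i
    rw [← measureReal_mem_eq_sum]
    simp
  unfold BorderInequality borderExcess
  simp only [h, sub_nonpos]

/-- Necessity of Border's inequalities: the winner has a type in the given sets at most as often as
some bidder does. -/
theorem Feasible.borderInequality (hD : iIndepFun (fun (i : Fin m) (t : ∀ j, T j) => t i) D)
    {π : ∀ i, T i → ℝ} (hπ : Feasible D π) (S : ∀ i, Set (T i)) : BorderInequality D π S := by
  obtain ⟨M, hM⟩ := hπ
  unfold BorderInequality
  rw [← measureReal_exists_mem hD S]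
  calc ∑ i, ∑ A with A ∈ S i, π i A * D.real {t | t i = A}
      ≤ ∑ i, ∑ A with A ∈ S i, ∫ t, (if t i = A then M.alloc t i else 0) ∂D := by
        refine Finset.sum_le_sum fun i _ => Finset.sum_le_sum fun A _ => ?_
        rw [← typeProb_mul_interim hD M i A, mul_comm]
        exact mul_le_mul_of_nonneg_left (hM i A) measureReal_nonneg
    _ = ∫ t, ∑ i, ∑ A with A ∈ S i, (if t i = A then M.alloc t i else 0) ∂D := by
        rw [integral_finsetSum _ fun _ _ => .of_finite]
        refine Finset.sum_congr rfl fun i _ => ?_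
        rw [integral_finsetSum _ fun _ _ => .of_finite]
    _ ≤ ∫ t, ({t | ∃ i, t i ∈ S i} : Set (∀ i, T i)).indicator 1 t ∂D := by
        refine integral_mono .of_finite .of_finite fun t => ?_
        simp only [Finset.sum_ite_eq, Finset.mem_filter, Finset.mem_univ, true_and]
        by_cases h : ∃ i, t i ∈ S i
        · rw [Set.indicator_of_mem (by exact h)]
          refine le_trans (Finset.sum_le_sum fun i _ => ?_) (M.sum_alloc_le_one t)
          split_ifs
          · exact le_rfl
          · exact M.alloc_nonneg t i
        · rw [Set.indicator_of_notMem (by exact h)]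
          push Not at h
          simp [h]
    _ = D.real {t | ∃ i, t i ∈ S i} := integral_indicator_one .of_discrete

/-- Sufficiency of Border's inequalities: by the fractional Hall theorem, the probability of every
type profile can be divided among the types of the profile so that type `A` of bidder `i` receives
`πᵢ(A) Pr[tᵢ = A]`. Types of probability zero are served separately: a bidder who is the only one
to report such a type gets the item. -/
theorem feasible_of_borderInequality
    (hD : iIndepFun (fun (i : Fin m) (t : ∀ j, T j) => t i) D)
    {π : ∀ i, T i → ℝ} (hπ : IsReducedForm π) (h : ∀ S, BorderInequality D π S) :
    Feasible D π := by
  obtain ⟨φ, hφ0, hφ1, hφR, hφd⟩ := exists_fractional_assignment (Ω := ∀ i, T i)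
    (J := Σ i, T i) (P := fun t => D.real {t}) (R := fun t j => t j.1 = j.2)
    (d := fun j => π j.1 j.2 * typeProb D j.1 j.2)
    (by
      intro S
      have hS := h fun i => {A | (⟨i, A⟩ : Σ i, T i) ∈ S}
      unfold BorderInequality at hS
      rw [← measureReal_exists_mem hD] at hS
      convert hS using 1
      · have hS' : ∑ j ∈ S, π j.1 j.2 * typeProb D j.1 j.2
            = ∑ j, if j ∈ S then π j.1 j.2 * typeProb D j.1 j.2 else 0 := by simp
        rw [hS', Fintype.sum_sigma]
        refine Finset.sum_congr rfl fun i _ => ?_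
        rw [Finset.sum_filter]
        refine Finset.sum_congr rfl fun A _ => ?_
        by_cases hA : (⟨i, A⟩ : Σ i, T i) ∈ S
        · rw [if_pos hA, if_pos (by exact hA)]
        · rw [if_neg hA, if_neg (by exact hA)]
      · rw [sum_measureReal_singleton]
        congr 1
        ext t
        simp only [Finset.coe_filter, Finset.mem_univ, true_and, Set.mem_ofPred_eq]
        constructor
        · rintro ⟨⟨i, A⟩, hj, hr⟩
          exact ⟨i, by rw [show t i = A from hr]; exact hj⟩
        · rintro ⟨i, hi⟩
          exact ⟨⟨i, t i⟩, hi, rfl⟩)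
    fun t => measureReal_nonneg
  set null : (∀ i, T i) → Fin m → Prop := fun t i => typeProb D i (t i) = 0 with hnull
  let M : Mechanism T :=
    { alloc := fun t i => if ∃ j, null t j then (if null t i ∧ ∀ j, null t j → j = i then 1 else 0)
        else φ t ⟨i, t i⟩
      alloc_nonneg := by
        intro t i
        split_ifs
        exacts [zero_le_one, le_rfl, hφ0 _ _]
      sum_alloc_le_one := by
        intro t
        split_ifs with hex
        · obtain ⟨j₀, hj₀⟩ := hex
          refine (Finset.sum_le_sum (g := fun i => if i = j₀ then (1 : ℝ) else 0)
            fun i _ => ?_).trans (by simp)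
          by_cases hi : i = j₀
          · rw [if_pos hi]
            split_ifs <;> norm_num
          · rw [if_neg (fun hc => hi (hc.2 j₀ hj₀).symm), if_neg hi]
        · refine le_trans ?_ (hφ1 t)
          rw [Fintype.sum_sigma]
          exact Finset.sum_le_sum fun i _ =>
            Finset.single_le_sum (f := fun A => φ t ⟨i, A⟩) (fun A _ => hφ0 t _)
              (Finset.mem_univ (t i)) }
  have hae : ∀ᵐ t ∂D, ∀ i, ¬ null t i := by
    rw [ae_all_iff]
    intro i
    have hz : D.real {t | t i ∈ Finset.univ.filter fun A => typeProb D i A = 0} = 0 := by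
      rw [measureReal_mem_eq_sum]
      exact Finset.sum_eq_zero fun A hA => by simpa using hA
    rw [measureReal_eq_zero_iff] at hz
    rw [ae_iff]
    convert hz using 2
    ext t
    simp [hnull]
  refine ⟨M, fun i A => ?_⟩
  by_cases hA : typeProb D i A = 0
  · have h1 : M.interim D i A = ∫ _, (1 : ℝ) ∂D := by
      refine integral_congr_ae (hae.mono fun t ht => ?_)
      have hi : null (Function.update t i A) i := by simpa [hnull] using hA
      have huniq : ∀ j, null (Function.update t i A) j → j = i := by
        intro j hj
        by_contra hji
        exact ht j (by simpa [hnull, hji] using hj)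
      simp only [M]
      rw [if_pos ⟨i, hi⟩, if_pos ⟨hi, huniq⟩]
    rw [h1]
    simpa using (hπ i A).2
  · have hpos : 0 < typeProb D i A := lt_of_le_of_ne measureReal_nonneg (Ne.symm hA)
    refine le_of_mul_le_mul_left ?_ hpos
    rw [typeProb_mul_interim hD M i A]
    have h1 : ∫ t, (if t i = A then M.alloc t i else 0) ∂D = ∫ t, φ t ⟨i, A⟩ ∂D := by
      refine integral_congr_ae (hae.mono fun t ht => ?_)
      by_cases htA : t i = A
      · have hex : ¬ ∃ j, null t j := by simpa using ht
        simp only [M, if_neg hex, if_pos htA]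
        rw [htA]
      · simp only [if_neg htA]
        exact (hφR t ⟨i, A⟩ htA).symm
    rw [h1, integral_fintype .of_finite, mul_comm]
    exact hφd ⟨i, A⟩

/-- Border's inequalities for the upper sets of `g · π` imply all others. -/
theorem feasible_of_threshold (hD : iIndepFun (fun (i : Fin m) (t : ∀ j, T j) => t i) D)
    {π g : ∀ i, T i → ℝ} (hπ : IsReducedForm π)
    (hg_lower : ∀ i A, ∑ B with π i B < π i A, typeProb D i B + typeProb D i A ≤ g i A)
    (hg_upper : ∀ i A, g i A ≤ ∑ B with π i B ≤ π i A, typeProb D i B)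
    (h : ∀ x : ℝ, borderExcess (typeProb D) π
      (fun i => Finset.univ.filter fun A => x < g i A * π i A) ≤ 0) :
    Feasible D π := by
  refine feasible_of_borderInequality hD hπ fun S => ?_
  rw [borderInequality_iff_borderExcess]
  obtain ⟨x, hx⟩ := exists_threshold_borderExcess_ge (fun i A => measureReal_nonneg)
    (fun i => sum_typeProb i) (fun i A => (hπ i A).1) hg_lower hg_upper
    fun i => Finset.univ.filter fun A => A ∈ S i
  exact hx.trans (h x)

theorem feasible_iff_virtualUpperSet
    (hD : iIndepFun (fun (i : Fin m) (t : ∀ j, T j) => t i) D)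
    {π : ∀ i, T i → ℝ} (hπ : IsReducedForm π) :
    Feasible D π ↔ ∀ x : ℝ, BorderInequality D π (virtualUpperSet D π x) := by
  refine ⟨fun h x => h.borderInequality hD _, fun h => ?_⟩
  have hg : ∀ i A, D.real {t | π i (t i) ≤ π i A} = ∑ B with π i B ≤ π i A, typeProb D i B := by
    intro i A
    rw [← measureReal_mem_eq_sum]
    simp
  refine feasible_of_threshold hD (g := fun i A => D.real {t | π i (t i) ≤ π i A}) hπ
    (fun i A => ?_) (fun i A => (hg i A).le) fun x => ?_
  · rw [hg, add_comm, ← Finset.sum_insert (by simp)]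
    refine Finset.sum_le_sum_of_subset_of_nonneg (fun B hB => ?_) fun B _ _ => measureReal_nonneg
    rcases Finset.mem_insert.mp hB with rfl | hB
    · simp
    · simpa using (Finset.mem_filter.mp hB).2.le
  · exact borderInequality_iff_borderExcess.mp (h x)

/-- A violated Border inequality separates `π` from the feasible reduced forms. -/
theorem separates_of_borderExcess_pos
    (hD : iIndepFun (fun (i : Fin m) (t : ∀ j, T j) => t i) D)
    {π : ∀ i, T i → ℝ} (S : ∀ i, Finset (T i)) (hS : 0 < borderExcess (typeProb D) π S) :
    Separates (fun i A => if A ∈ S i then typeProb D i A else 0)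
      (1 - ∏ i, (1 - ∑ A ∈ S i, typeProb D i A)) π (feasibleSet D) := by
  have hsum : ∀ y : ∀ i, T i → ℝ,
      ∑ i, ∑ A, (if A ∈ S i then typeProb D i A else 0) * y i A
        = ∑ i, ∑ A ∈ S i, y i A * typeProb D i A := by
    intro y
    refine Finset.sum_congr rfl fun i _ => ?_
    simp [mul_comm]
  have hlt : 1 - ∏ i, (1 - ∑ A ∈ S i, typeProb D i A)
      < ∑ i, ∑ A, (if A ∈ S i then typeProb D i A else 0) * π i A := by
    rw [hsum]
    unfold borderExcess at hS
    linarith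
  refine ⟨fun h0 => ?_, fun y hy => ?_, hlt⟩
  · have h1 : ∀ i A, (if A ∈ S i then typeProb D i A else 0) = 0 :=
      fun i A => congrFun (congrFun h0 i) A
    have h2 : ∀ i, ∑ A ∈ S i, typeProb D i A = 0 :=
      fun i => Finset.sum_eq_zero fun A hA => by simpa [hA] using h1 i A
    simp [h1, h2] at hlt
  · have := hy.2.borderInequality hD fun i => (S i : Set (T i))
    rw [borderInequality_iff_borderExcess] at this
    rw [hsum]
    unfold borderExcess at this
    simp only [Finset.mem_coe, Finset.filter_univ_mem] at this
    linarith

end Border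

end Auction

namespace RealRAM

/-! ### Running times of programs -/

/-- Started in memory `s`, the program `c` halts within `t` units of time in a memory satisfying
`Q`. -/
def Runs (c : Cmd) (s : State) (t : ℕ) (Q : State → Prop) : Prop :=
  ∃ s' k, Exec c s s' k ∧ k ≤ t ∧ Q s'

theorem Runs.mono {c : Cmd} {s : State} {t t' : ℕ} {Q Q' : State → Prop} (h : Runs c s t Q)
    (ht : t ≤ t') (hQ : ∀ s, Q s → Q' s) : Runs c s t' Q' := by
  obtain ⟨s', k, he, hk, hs'⟩ := h
  exact ⟨s', k, he, hk.trans ht, hQ s' hs'⟩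

theorem Runs.seq {c d : Cmd} {s : State} {t₁ t₂ : ℕ} {P Q : State → Prop} (h : Runs c s t₁ P)
    (h' : ∀ s, P s → Runs d s t₂ Q) : Runs (.seq c d) s (t₁ + t₂) Q := by
  obtain ⟨s₁, k, he, hk, hs₁⟩ := h
  obtain ⟨s₂, l, he', hl, hs₂⟩ := h' s₁ hs₁
  exact ⟨s₂, k + l, he.seq he', add_le_add hk hl, hs₂⟩

theorem Runs.ite {b : Test} {c d : Cmd} {s : State} {t : ℕ} {Q : State → Prop}
    (h : b.Holds s → Runs c s t Q) (h' : ¬ b.Holds s → Runs d s t Q) :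
    Runs (.ite b c d) s (b.cost + t) Q := by
  by_cases hb : b.Holds s
  · obtain ⟨s', k, he, hk, hs'⟩ := h hb
    exact ⟨s', _, he.iteTrue hb, by omega, hs'⟩
  · obtain ⟨s', k, he, hk, hs'⟩ := h' hb
    exact ⟨s', _, he.iteFalse hb, by omega, hs'⟩

/-- A loop with invariant `I` whose test succeeds exactly `n` times. -/
theorem Runs.loop {b : Test} {c : Cmd} {t n : ℕ} {I : ℕ → State → Prop}
    (hstep : ∀ j < n, ∀ s, I j s → b.Holds s ∧ Runs c s t (I (j + 1)))
    (hend : ∀ s, I n s → ¬ b.Holds s) {s : State} (h0 : I 0 s) :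
    Runs (.loop b c) s (n * (b.cost + t) + b.cost) (I n) := by
  have key : ∀ r j, j + r = n → ∀ s, I j s →
      Runs (.loop b c) s (r * (b.cost + t) + b.cost) (I n) := by
    intro r
    induction r with
    | zero =>
      intro j hj s hs
      obtain rfl : j = n := by omega
      exact ⟨s, _, .loopFalse (hend s hs), by omega, hs⟩
    | succ r ih =>
      intro j hj s hs
      obtain ⟨hb, s₁, k, he, hk, hs₁⟩ := hstep j (by omega) s hs
      obtain ⟨s₂, l, he', hl, hs₂⟩ := ih (j + 1) (by omega) s₁ hs₁
      refine ⟨s₂, _, .loopTrue hb he he', ?_, hs₂⟩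
      rw [add_one_mul]
      omega
  exact key n 0 (by omega) s h0

/-- Programs without tests. -/
def Cmd.StraightLine : Cmd → Prop
  | .seq c d => c.StraightLine ∧ d.StraightLine
  | .ite _ _ _ => False
  | .loop _ _ => False
  | _ => True

/-- The effect of a straight-line program on the memory (tests and loops are ignored). -/
noncomputable def Cmd.run : Cmd → State → State
  | .skip, s => s
  | .setN x e, s => { s with nvar := Function.update s.nvar x (e.eval s) }
  | .setR x e, s => { s with rvar := Function.update s.rvar x (e.eval s) }
  | .writeN a j e, s =>
      { s with narr := Function.update s.narr a
                        (Function.update (s.narr a) (j.eval s) (e.eval s)) }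
  | .writeR a j e, s =>
      { s with rarr := Function.update s.rarr a
                        (Function.update (s.rarr a) (j.eval s) (e.eval s)) }
  | .seq c d, s => d.run (c.run s)
  | .ite _ _ _, s => s
  | .loop _ _, s => s

/-- The running time of a straight-line program. -/
def Cmd.time : Cmd → ℕ
  | .skip => 1
  | .setN _ e => e.cost + 1
  | .setR _ e => e.cost + 1
  | .writeN _ j e => j.cost + e.cost + 1
  | .writeR _ j e => j.cost + e.cost + 1
  | .seq c d => c.time + d.time
  | .ite _ _ _ => 0
  | .loop _ _ => 0

theorem Cmd.StraightLine.runs {c : Cmd} {t : ℕ} (hc : c.StraightLine ∧ c.time ≤ t) {s : State}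
    {Q : State → Prop} (h : Q (c.run s)) : Runs c s t Q := by
  suffices Runs c s c.time Q from this.mono hc.2 fun _ => id
  replace hc := hc.1
  induction c generalizing s Q with
  | skip => exact ⟨_, _, .skip s, le_rfl, h⟩
  | setN x e => exact ⟨_, _, .setN s x e, le_rfl, h⟩
  | setR x e => exact ⟨_, _, .setR s x e, le_rfl, h⟩
  | writeN a j e => exact ⟨_, _, .writeN s a j e, le_rfl, h⟩
  | writeR a j e => exact ⟨_, _, .writeR s a j e, le_rfl, h⟩
  | seq c d ihc ihd =>
    exact (ihc (Q := fun s' => s' = c.run s) rfl hc.1).seq fun s' hs' =>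
      ihd (by rw [hs']; exact h) hc.2
  | ite b c d _ _ => exact hc.elim
  | loop b c _ => exact hc.elim

/-! ### Merge sort -/

/-- `a` restricts to a permutation of `{0, …, N - 1}`. -/
def IsIndexPerm (N : ℕ) (a : ℕ → ℕ) : Prop :=
  (∀ p < N, a p < N) ∧ ∀ p < N, ∀ q < N, a p = a q → p = q

/-- The keys of `a 0, …, a (N - 1)` increase on each of the blocks `[r * w, (r + 1) * w)`. -/
def BlockSorted (N w : ℕ) (key : ℕ → ℝ) (a : ℕ → ℕ) : Prop :=
  ∀ r p q, r * w ≤ p → p ≤ q → q < (r + 1) * w → q < N → key (a p) ≤ key (a q)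

/-- The invariant of one pass of bottom-up merge sort. The blocks of `a` of width `w` are merged in
pairs into `b`, of which the first `k` cells are filled; the current pair of blocks starts at `lo`,
and `i` and `j` are the next positions to be read in the two blocks. -/
structure MergeInv (N w : ℕ) (key : ℕ → ℝ) (a : ℕ → ℕ) (lo i j k : ℕ) (b : ℕ → ℕ) : Prop where
  start : ∃ r, lo = r * (2 * w)
  lo_le_i : lo ≤ i
  i_le : i ≤ lo + w
  le_j : lo + w ≤ j
  j_le : j ≤ lo + 2 * w
  j_bound : j ≤ N ∨ j = lo + w
  count : i + j = k + lo + w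
  image : ∀ p < k, ∃ q, (q < i ∨ lo + w ≤ q ∧ q < j) ∧ b p = a q
  inj : ∀ p < k, ∀ q < k, b p = b q → p = q
  sorted : ∀ r p q, r * (2 * w) ≤ p → p ≤ q → q < (r + 1) * (2 * w) → q < k →
    key (b p) ≤ key (b q)
  le_left : i < lo + w → i < N → ∀ p, lo ≤ p → p < k → key (b p) ≤ key (a i)
  le_right : j < lo + 2 * w → j < N → ∀ p, lo ≤ p → p < k → key (b p) ≤ key (a j)

section Merge

variable {N w : ℕ} {key : ℕ → ℝ} {a : ℕ → ℕ} {lo i j k : ℕ} {b : ℕ → ℕ}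

theorem MergeInv.zero (b : ℕ → ℕ) : MergeInv N w key a 0 0 w 0 b where
  start := ⟨0, by simp⟩
  lo_le_i := le_rfl
  i_le := by omega
  le_j := by omega
  j_le := by omega
  j_bound := by omega
  count := by omega
  image := by simp
  inj := by simp
  sorted := by simp
  le_left := by simp
  le_right := by simp

theorem MergeInv.nextBlock (h : MergeInv N w key a lo i j k b) (hk : lo + w + w ≤ k) :
    MergeInv N w key a k k (k + w) k b := by
  have h1 := h.i_le
  have h2 := h.j_le
  have h3 := h.count
  obtain ⟨r, hr⟩ := h.start
  refine ⟨⟨r + 1, by rw [add_one_mul]; omega⟩, le_rfl, by omega, by omega, by omega, by omega,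
    by omega, fun p hp => ?_, h.inj, h.sorted, fun _ _ p hp hp' => by omega,
    fun _ _ p hp hp' => by omega⟩
  obtain ⟨q, hq, he⟩ := h.image p hp
  exact ⟨q, by omega, he⟩

/-- Appending the element `a c` of either block, where `c` is the next position of that block, to
the merged part. -/
theorem MergeInv.append (h : MergeInv N w key a lo i j k b) (ha : IsIndexPerm N a) {c i' j' : ℕ}
    (hk : k < lo + w + w) (hkN : k < N)
    (hc : c = i ∧ i' = i + 1 ∧ j' = j ∧ i < lo + w ∨
      c = j ∧ i' = i ∧ j' = j + 1 ∧ j < lo + 2 * w ∧ j < N)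
    (hle : ∀ p, lo ≤ p → p < k → key (b p) ≤ key (a c))
    (hleft : i' < lo + w → i' < N → key (a c) ≤ key (a i'))
    (hright : j' < lo + 2 * w → j' < N → key (a c) ≤ key (a j')) :
    MergeInv N w key a lo i' j' (k + 1) (Function.update b k (a c)) := by
  obtain ⟨h0, h1, h2, h3, h4, h5, h6, h7, h8, h9, h10, h11⟩ := h
  have hb : ∀ p < k, Function.update b k (a c) p = b p :=
    fun p hp => Function.update_of_ne (by omega) _ _
  have hnew : ∀ p < k, b p ≠ a c := by
    intro p hp he
    obtain ⟨q, hq, he'⟩ := h7 p hp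
    have := ha.2 q (by omega) c (by omega) (he'.symm.trans he)
    omega
  have hlast : ∀ p, lo ≤ p → p < k + 1 → key (Function.update b k (a c) p) ≤ key (a c) := by
    intro p hp hpk
    rcases Nat.lt_succ_iff_lt_or_eq.mp hpk with hlt | rfl
    · rw [hb p hlt]; exact hle p hp hlt
    · rw [Function.update_self]
  refine ⟨h0, by omega, by omega, by omega, by omega, by omega, by omega, fun p hp => ?_,
    fun p hp q hq he => ?_, fun r p q hp hpq hq hqk => ?_, fun hi hiN p hp hpk => ?_,
    fun hj hjN p hp hpk => ?_⟩
  · rcases Nat.lt_succ_iff_lt_or_eq.mp hp with hlt | rfl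
    · obtain ⟨q, hq, he⟩ := h7 p hlt
      exact ⟨q, by omega, by rw [hb p hlt, he]⟩
    · exact ⟨c, by omega, Function.update_self ..⟩
  · rcases Nat.lt_succ_iff_lt_or_eq.mp hp with hlt | rfl <;>
      rcases Nat.lt_succ_iff_lt_or_eq.mp hq with hlt' | rfl
    · rw [hb p hlt, hb q hlt'] at he
      exact h8 p hlt q hlt' he
    · rw [hb p hlt, Function.update_self] at he
      exact absurd he (hnew p hlt)
    · rw [hb q hlt', Function.update_self] at he
      exact absurd he.symm (hnew q hlt')
    · rfl
  · rcases Nat.lt_succ_iff_lt_or_eq.mp hqk with hlt | rfl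
    · rw [hb p (by omega), hb q hlt]
      exact h9 r p q hp hpq hq hlt
    · -- the block that contains the last position is the current one
      obtain ⟨r₀, rfl⟩ := h0
      have hr : r = r₀ := by
        have e1 : r * (2 * w) < (r₀ + 1) * (2 * w) := by rw [add_one_mul]; omega
        have e2 : r₀ * (2 * w) < (r + 1) * (2 * w) := by omega
        have := Nat.lt_of_mul_lt_mul_right e1
        have := Nat.lt_of_mul_lt_mul_right e2
        omega
      subst hr
      rw [Function.update_self]
      exact hlast p hp (by omega)
  · exact (hlast p hp hpk).trans (hleft hi hiN)
  · exact (hlast p hp hpk).trans (hright hj hjN)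

theorem BlockSorted.succ_le (h : BlockSorted N w key a) {r p : ℕ} (h1 : r * w ≤ p)
    (h2 : p + 1 < (r + 1) * w) (h3 : p + 1 < N) : key (a p) ≤ key (a (p + 1)) :=
  h r p (p + 1) h1 (by omega) h2 h3

theorem MergeInv.takeLeft (h : MergeInv N w key a lo i j k b) (ha : IsIndexPerm N a)
    (hs : BlockSorted N w key a) (hk : k < lo + w + w) (hkN : k < N) (hi : i < lo + w)
    (hle : j < lo + 2 * w → j < N → key (a i) ≤ key (a j)) :
    MergeInv N w key a lo (i + 1) j (k + 1) (Function.update b k (a i)) := by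
  refine h.append ha hk hkN (.inl ⟨rfl, rfl, rfl, hi⟩) (h.le_left hi ?_) (fun h1 h2 => ?_) hle
  · have := h.count
    have := h.le_j
    omega
  · obtain ⟨r, hr⟩ := h.start
    have h3 := h.lo_le_i
    have e : 2 * r * w = r * (2 * w) := by ring
    exact hs.succ_le (r := 2 * r) (by omega) (by rw [add_one_mul]; omega) h2

theorem MergeInv.takeRight (h : MergeInv N w key a lo i j k b) (ha : IsIndexPerm N a)
    (hs : BlockSorted N w key a) (hk : k < lo + w + w) (hkN : k < N)
    (hle : i < lo + w → (j < lo + 2 * w ∧ j < N) ∧ key (a j) ≤ key (a i)) :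
    MergeInv N w key a lo i (j + 1) (k + 1) (Function.update b k (a j)) := by
  have hj : j < lo + 2 * w ∧ j < N := by
    by_cases hi : i < lo + w
    · exact (hle hi).1
    · have := h.i_le
      have := h.count
      omega
  refine h.append ha hk hkN (.inr ⟨rfl, rfl, rfl, hj⟩) (h.le_right hj.1 hj.2)
    (fun h1 _ => (hle h1).2) fun h1 h2 => ?_
  obtain ⟨r, hr⟩ := h.start
  have h3 := h.le_j
  have e : (2 * r + 1) * w = r * (2 * w) + w := by ring
  exact hs.succ_le (r := 2 * r + 1) (by omega) (by rw [add_one_mul]; omega) h2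

theorem MergeInv.isIndexPerm (h : MergeInv N w key a lo i j N b) (ha : IsIndexPerm N a) :
    IsIndexPerm N b := by
  refine ⟨fun p hp => ?_, h.inj⟩
  obtain ⟨q, hq, he⟩ := h.image p hp
  have h1 := h.count
  have h2 := h.le_j
  have h3 := h.j_bound
  rw [he]
  exact ha.1 q (by omega)

end Merge

end RealRAM

namespace RealRAM

/-- The registers `3, …, 7` and the arrays `1, 2` of natural numbers are all that differs between
`s` and `s'`. -/
structure SortFrame (s s' : State) : Prop where
  rvar : s'.rvar = s.rvar
  rarr : s'.rarr = s.rarr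
  nvar₀ : s'.nvar 0 = s.nvar 0
  nvar₁ : s'.nvar 1 = s.nvar 1
  nvar₂ : s'.nvar 2 = s.nvar 2
  narr : s'.narr 0 = s.narr 0

theorem SortFrame.refl (s : State) : SortFrame s s := ⟨rfl, rfl, rfl, rfl, rfl, rfl⟩

theorem SortFrame.trans {s s' s'' : State} (h : SortFrame s s') (h' : SortFrame s' s'') :
    SortFrame s s'' :=
  ⟨h'.rvar.trans h.rvar, h'.rarr.trans h.rarr, h'.nvar₀.trans h.nvar₀, h'.nvar₁.trans h.nvar₁,
    h'.nvar₂.trans h.nvar₂, h'.narr.trans h.narr⟩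

theorem SortFrame.of_eq {s s' s'' : State} (h : SortFrame s s') (hr : s''.rvar = s'.rvar)
    (hra : s''.rarr = s'.rarr) (h0 : s''.nvar 0 = s'.nvar 0) (h1 : s''.nvar 1 = s'.nvar 1)
    (h2 : s''.nvar 2 = s'.nvar 2) (ha : s''.narr 0 = s'.narr 0) : SortFrame s s'' :=
  h.trans ⟨hr, hra, h0, h1, h2, ha⟩

/-- One step of the merge of array `1` into array `2`. The registers `3, …, 7` hold the width `w`,
the start `lo` of the current pair of blocks, the positions `i` and `j` in its two blocks, and the
number `k` of cells that have been filled; the keys are in the real array `κ`. -/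
def mergeStep (κ : ℕ) : Cmd :=
  .seq
    (.ite (.nle (.add (.add (.var 4) (.var 3)) (.var 3)) (.var 7))
      (.seq (.setN 4 (.var 7)) (.seq (.setN 5 (.var 7)) (.setN 6 (.add (.var 7) (.var 3)))))
      .skip)
    (.seq
      (.ite
        (.and (.nle (.add (.var 5) (.const 1)) (.add (.var 4) (.var 3)))
          (.not
            (.and
              (.and (.nle (.add (.var 6) (.const 1)) (.add (.add (.var 4) (.var 3)) (.var 3)))
                (.nle (.add (.var 6) (.const 1)) (.var 0)))
              (.not (.rle (.read κ (.read 1 (.var 5))) (.read κ (.read 1 (.var 6))))))))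
        (.seq (.writeN 2 (.var 7) (.read 1 (.var 5))) (.setN 5 (.add (.var 5) (.const 1))))
        (.seq (.writeN 2 (.var 7) (.read 1 (.var 6))) (.setN 6 (.add (.var 6) (.const 1)))))
      (.setN 7 (.add (.var 7) (.const 1))))

/-- The test `k < N` for the register `x` that holds `k`. -/
def ltN (x : ℕ) : Test := .nle (.add (.var x) (.const 1)) (.var 0)

/-- Copies one cell of array `2` back to array `1`. -/
def copyStep : Cmd :=
  .seq (.writeN 1 (.var 7) (.read 2 (.var 7))) (.setN 7 (.add (.var 7) (.const 1)))

/-- Writes the cell `k` of the identity permutation into array `1`. -/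
def initStep : Cmd :=
  .seq (.writeN 1 (.var 7) (.var 7)) (.setN 7 (.add (.var 7) (.const 1)))

/-- One pass of merge sort, which doubles the width of the sorted blocks. -/
def mergePass (κ : ℕ) : Cmd :=
  .seq (.seq (.setN 4 (.const 0)) (.seq (.setN 5 (.const 0)) (.seq (.setN 6 (.var 3))
      (.setN 7 (.const 0)))))
    (.seq (.loop (ltN 7) (mergeStep κ))
      (.seq (.setN 7 (.const 0))
        (.seq (.loop (ltN 7) copyStep) (.setN 3 (.add (.var 3) (.var 3))))))

/-- Bottom-up merge sort: writes into array `1` the indices `0, …, N - 1` in the increasing order of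
their keys in the real array `κ`. -/
def sortCmd (κ : ℕ) : Cmd :=
  .seq (.setN 7 (.const 0))
    (.seq (.loop (ltN 7) initStep)
      (.seq (.setN 3 (.const 1)) (.loop (ltN 3) (mergePass κ))))

section MergeSort

variable {κ N w : ℕ} {a : ℕ → ℕ} {s₀ s : State}

theorem mergeStep_spec {k : ℕ} (hN : s₀.nvar 0 = N) (ha : IsIndexPerm N a)
    (hb : BlockSorted N w (s₀.rarr κ) a) (hk : k < N) (hw : 0 < w)
    (hs : SortFrame s₀ s ∧ s.nvar 3 = w ∧ s.narr 1 = a ∧ s.nvar 7 = k ∧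
      MergeInv N w (s₀.rarr κ) a (s.nvar 4) (s.nvar 5) (s.nvar 6) k (s.narr 2)) :
    Runs (mergeStep κ) s 200 fun s => SortFrame s₀ s ∧ s.nvar 3 = w ∧
      s.narr 1 = a ∧ s.nvar 7 = k + 1 ∧
      MergeInv N w (s₀.rarr κ) a (s.nvar 4) (s.nvar 5) (s.nvar 6) (k + 1) (s.narr 2) := by
  unfold mergeStep
  refine Runs.mono (Runs.seq
    (P := fun s => (SortFrame s₀ s ∧ s.nvar 3 = w ∧ s.narr 1 = a ∧ s.nvar 7 = k ∧
      MergeInv N w (s₀.rarr κ) a (s.nvar 4) (s.nvar 5) (s.nvar 6) k (s.narr 2)) ∧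
      k < s.nvar 4 + w + w)
    (Runs.ite (fun h => Cmd.StraightLine.runs (t := 30) (by simp [Cmd.StraightLine, Cmd.time, NExpr.cost]) ?_)
      fun h => Cmd.StraightLine.runs (t := 30) (by simp [Cmd.StraightLine, Cmd.time]) ?_)
    fun s hs => Runs.seq
      (P := fun s => SortFrame s₀ s ∧ s.nvar 3 = w ∧ s.narr 1 = a ∧ s.nvar 7 = k ∧
        MergeInv N w (s₀.rarr κ) a (s.nvar 4) (s.nvar 5) (s.nvar 6) (k + 1) (s.narr 2))
    (Runs.ite (fun h => Cmd.StraightLine.runs (t := 30) (by simp [Cmd.StraightLine, Cmd.time, NExpr.cost]) ?_)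
      fun h => Cmd.StraightLine.runs (t := 30) (by simp [Cmd.StraightLine, Cmd.time, NExpr.cost]) ?_)
    fun s hs => Cmd.StraightLine.runs (t := 30) (by simp [Cmd.StraightLine, Cmd.time, NExpr.cost]) ?_) ?_ fun _ => id
  · obtain ⟨hf, h3, h1, h7, hm⟩ := hs
    simp only [Test.Holds, NExpr.eval, h3, h7] at h
    simp only [Cmd.run, NExpr.eval]
    refine ⟨⟨hf.of_eq rfl rfl (by simp) (by simp) (by simp) (by simp), ?_, ?_, ?_, ?_⟩, ?_⟩
    · simpa using h3
    · simpa using h1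
    · simpa using h7
    · simpa [Function.update_apply, h3, h7] using hm.nextBlock h
    · simp [h7]
      omega
  · obtain ⟨hf, h3, h1, h7, hm⟩ := hs
    simp only [Test.Holds, NExpr.eval, h3, h7] at h
    exact ⟨⟨hf, h3, h1, h7, hm⟩, not_le.mp h⟩
  · obtain ⟨⟨hf, h3, h1, h7, hm⟩, hlt⟩ := hs
    simp only [Test.Holds, NExpr.eval, RExpr.eval, h3, h1, hf.rarr, hf.nvar₀.trans hN] at h
    simp only [Cmd.run, NExpr.eval]
    refine ⟨hf.of_eq rfl rfl (by simp) (by simp) (by simp) (by simp), ?_, ?_, ?_, ?_⟩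
    · simpa using h3
    · simpa using h1
    · simpa using h7
    · have := hm.takeLeft ha hb hlt hk (by omega) fun h4 h5 => by
        by_contra hc
        exact h.2 ⟨⟨by omega, by omega⟩, hc⟩
      simpa [Function.update_apply, h7, h1] using this
  · obtain ⟨⟨hf, h3, h1, h7, hm⟩, hlt⟩ := hs
    simp only [Test.Holds, NExpr.eval, RExpr.eval, h3, h1, hf.rarr, hf.nvar₀.trans hN] at h
    simp only [Cmd.run, NExpr.eval]
    refine ⟨hf.of_eq rfl rfl (by simp) (by simp) (by simp) (by simp), ?_, ?_, ?_, ?_⟩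
    · simpa using h3
    · simpa using h1
    · simpa using h7
    · have := hm.takeRight ha hb hlt hk fun h4 => by
        rw [not_and, not_not] at h
        obtain ⟨⟨h5, h6⟩, h8⟩ := h (by omega)
        exact ⟨⟨by omega, by omega⟩, (not_le.mp h8).le⟩
      simpa [Function.update_apply, h7, h1] using this
  · obtain ⟨hf, h3, h1, h7, hm⟩ := hs
    simp only [Cmd.run, NExpr.eval]
    refine ⟨hf.of_eq rfl rfl (by simp) (by simp) (by simp) (by simp), ?_, ?_, ?_, ?_⟩
    · simpa using h3
    · simpa using h1
    · simp [h7]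
    · simpa [Function.update_apply] using hm
  · simp [Test.cost, NExpr.cost, RExpr.cost]

theorem mergePass_spec (hN : s₀.nvar 0 = N) (hN1 : 1 ≤ N) (ha : IsIndexPerm N a)
    (hb : BlockSorted N w (s₀.rarr κ) a) (hw : 0 < w)
    (hs : SortFrame s₀ s ∧ s.nvar 3 = w ∧ s.narr 1 = a) :
    Runs (mergePass κ) s (N * 400) fun s => SortFrame s₀ s ∧
      s.nvar 3 = w + w ∧ IsIndexPerm N (s.narr 1) ∧
      BlockSorted N (2 * w) (s₀.rarr κ) (s.narr 1) := by
  unfold mergePass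
  refine Runs.mono (Runs.seq (P := fun s => SortFrame s₀ s ∧ s.nvar 3 = w ∧ s.narr 1 = a ∧
      s.nvar 7 = 0 ∧
      MergeInv N w (s₀.rarr κ) a (s.nvar 4) (s.nvar 5) (s.nvar 6) 0 (s.narr 2))
      (Cmd.StraightLine.runs (t := 30) (by simp [Cmd.StraightLine, Cmd.time, NExpr.cost]) ?_)
    fun s hs => Runs.seq (Runs.loop (n := N)
      (I := fun k s => SortFrame s₀ s ∧ s.nvar 3 = w ∧ s.narr 1 = a ∧ s.nvar 7 = k ∧
        MergeInv N w (s₀.rarr κ) a (s.nvar 4) (s.nvar 5) (s.nvar 6) k (s.narr 2))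
      (fun k hk s hs => ⟨?_, mergeStep_spec hN ha hb hk hw hs⟩) (fun s hs => ?_) hs)
    fun s₁ hs₁ => Runs.seq (P := fun s => SortFrame s₀ s ∧ s.nvar 3 = w ∧ s.narr 2 = s₁.narr 2 ∧
      s.nvar 7 = 0 ∧ ∀ p < 0, s.narr 1 p = s₁.narr 2 p)
      (Cmd.StraightLine.runs (t := 30) (by simp [Cmd.StraightLine, Cmd.time, NExpr.cost]) ?_)
    fun s hs => Runs.seq (Runs.loop (n := N)
      (I := fun k s => SortFrame s₀ s ∧ s.nvar 3 = w ∧ s.narr 2 = s₁.narr 2 ∧ s.nvar 7 = k ∧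
        ∀ p < k, s.narr 1 p = s₁.narr 2 p)
      (fun k hk s hs => ⟨?_, Cmd.StraightLine.runs (t := 30) (by simp [Cmd.StraightLine, Cmd.time, NExpr.cost, copyStep]) ?_⟩)
      (fun s hs => ?_) hs)
    fun s hs => Cmd.StraightLine.runs (t := 30) (by simp [Cmd.StraightLine, Cmd.time, NExpr.cost]) ?_) ?_ fun _ => id
  · obtain ⟨hf, h3, h1⟩ := hs
    simp only [Cmd.run, NExpr.eval]
    refine ⟨hf.of_eq rfl rfl (by simp) (by simp) (by simp) (by simp), ?_, ?_, ?_, ?_⟩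
    · simpa using h3
    · simpa using h1
    · simp
    · simpa [Function.update_apply, h3] using MergeInv.zero (s.narr 2)
  · obtain ⟨hf, -, -, h7, -⟩ := hs
    simp only [ltN, Test.Holds, NExpr.eval, h7, hf.nvar₀.trans hN]
    omega
  · obtain ⟨hf, -, -, h7, -⟩ := hs
    simp only [ltN, Test.Holds, NExpr.eval, h7, hf.nvar₀.trans hN]
    omega
  · obtain ⟨hf, h3, -⟩ := hs₁
    simp only [Cmd.run, NExpr.eval]
    refine ⟨hf.of_eq rfl rfl (by simp) (by simp) (by simp) (by simp), ?_, by simp, ?_, by simp⟩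
    · simpa using h3
    · simp
  · obtain ⟨hf, -, -, h7, -⟩ := hs
    simp only [ltN, Test.Holds, NExpr.eval, h7, hf.nvar₀.trans hN]
    omega
  · obtain ⟨hf, h3, h2, h7, h1⟩ := hs
    simp only [Cmd.run, copyStep, NExpr.eval]
    refine ⟨hf.of_eq rfl rfl (by simp) (by simp) (by simp) (by simp), ?_, ?_, ?_, fun p hp => ?_⟩
    · simpa using h3
    · simpa using h2
    · simp [h7]
    · rcases Nat.lt_succ_iff_lt_or_eq.mp hp with hlt | rfl
      · simpa [h7, Function.update_apply, hlt.ne] using h1 p hlt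
      · simp [h7, h2]
  · obtain ⟨hf, -, -, h7, -⟩ := hs
    simp only [ltN, Test.Holds, NExpr.eval, h7, hf.nvar₀.trans hN]
    omega
  · obtain ⟨-, -, -, -, hm⟩ := hs₁
    obtain ⟨hf, h3, -, -, h1⟩ := hs
    have hp := hm.isIndexPerm ha
    simp only [Cmd.run, NExpr.eval]
    refine ⟨hf.of_eq rfl rfl (by simp) (by simp) (by simp) (by simp), ?_, ⟨fun p hpN => ?_,
      fun p hpN q hqN he => ?_⟩, fun r p q hrp hpq hqr hqN => ?_⟩
    · simp [h3]
    · rw [h1 p hpN]; exact hp.1 p hpN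
    · rw [h1 p hpN, h1 q hqN] at he
      exact hp.2 p hpN q hqN he
    · rw [h1 p (by omega), h1 q hqN]
      exact hm.sorted r p q hrp hpq hqr hqN
  · simp only [NExpr.cost, Test.cost, ltN]
    omega

theorem sortCmd_spec (κ : ℕ) (hN : s.nvar 0 = N) (hN1 : 1 ≤ N) :
    Runs (sortCmd κ) s (N * (Nat.clog 2 N + 1) * 600) fun s' =>
      SortFrame s s' ∧ IsIndexPerm N (s'.narr 1) ∧
      ∀ p q, p ≤ q → q < N → s.rarr κ (s'.narr 1 p) ≤ s.rarr κ (s'.narr 1 q) := by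
  unfold sortCmd
  refine Runs.mono (Runs.seq (P := fun s' => SortFrame s s' ∧ s'.nvar 7 = 0 ∧
      ∀ p < 0, s'.narr 1 p = p)
      (Cmd.StraightLine.runs (t := 30) (by simp [Cmd.StraightLine, Cmd.time, NExpr.cost]) ?_)
    fun s' hs' => Runs.seq (Runs.loop (n := N)
      (I := fun k s' => SortFrame s s' ∧ s'.nvar 7 = k ∧ ∀ p < k, s'.narr 1 p = p)
      (fun k hk s' hs' => ⟨?_, Cmd.StraightLine.runs (t := 30) (by simp [Cmd.StraightLine, Cmd.time, NExpr.cost, initStep]) ?_⟩)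
      (fun s' hs' => ?_) hs')
    fun s' hs' => Runs.seq (P := fun s' => SortFrame s s' ∧ s'.nvar 3 = 2 ^ 0 ∧
        IsIndexPerm N (s'.narr 1) ∧ BlockSorted N (2 ^ 0) (s.rarr κ) (s'.narr 1))
      (Cmd.StraightLine.runs (t := 30) (by simp [Cmd.StraightLine, Cmd.time, NExpr.cost]) ?_)
    fun s' hs' => Runs.loop (n := Nat.clog 2 N)
      (I := fun l s' => SortFrame s s' ∧ s'.nvar 3 = 2 ^ l ∧
        IsIndexPerm N (s'.narr 1) ∧ BlockSorted N (2 ^ l) (s.rarr κ) (s'.narr 1))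
      (fun l hl s' hs' => ⟨?_, (mergePass_spec hN hN1 hs'.2.2.1 hs'.2.2.2 (by positivity)
        ⟨hs'.1, hs'.2.1, rfl⟩).mono le_rfl fun s' hs' => ?_⟩)
      (fun s' hs' => ?_) hs') ?_ fun s' hs' => ?_
  · simp only [Cmd.run, NExpr.eval]
    refine ⟨(SortFrame.refl s).of_eq rfl rfl (by simp) (by simp) (by simp) (by simp), by simp, by simp⟩
  · obtain ⟨hf, h7, -⟩ := hs'
    simp only [ltN, Test.Holds, NExpr.eval, h7, hf.nvar₀.trans hN]
    omega
  · obtain ⟨hf, h7, h1⟩ := hs'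
    simp only [Cmd.run, initStep, NExpr.eval]
    refine ⟨hf.of_eq rfl rfl (by simp) (by simp) (by simp) (by simp), ?_, fun p hp => ?_⟩
    · simp [h7]
    · rcases Nat.lt_succ_iff_lt_or_eq.mp hp with hlt | rfl
      · simpa [h7, Function.update_apply, hlt.ne] using h1 p hlt
      · simp [h7]
  · obtain ⟨hf, h7, -⟩ := hs'
    simp only [ltN, Test.Holds, NExpr.eval, h7, hf.nvar₀.trans hN]
    omega
  · obtain ⟨hf, -, h1⟩ := hs'
    simp only [Cmd.run, NExpr.eval]
    refine ⟨hf.of_eq rfl rfl (by simp) (by simp) (by simp) (by simp), by simp, ⟨fun p hp => ?_,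
      fun p hp q hq he => ?_⟩, fun r p q hrp hpq hqr hqN => ?_⟩
    · rw [h1 p hp]; exact hp
    · rwa [h1 p hp, h1 q hq] at he
    · obtain rfl : p = q := by omega
      exact le_rfl
  · obtain ⟨hf, h3, -⟩ := hs'
    have := (Nat.lt_clog_iff_pow_lt (by norm_num)).mp hl
    simp only [ltN, Test.Holds, NExpr.eval, h3, hf.nvar₀.trans hN]
    omega
  · obtain ⟨hf, h3, h1, h2⟩ := hs'
    refine ⟨hf, ?_, h1, ?_⟩
    · rw [h3]; ring
    · rwa [pow_succ']
  · obtain ⟨hf, h3, -⟩ := hs'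
    have := Nat.le_pow_clog (b := 2) (by norm_num) N
    simp only [ltN, Test.Holds, NExpr.eval, h3, hf.nvar₀.trans hN]
    omega
  · have h1 := Nat.mul_le_mul_left (Nat.clog 2 N) hN1
    simp only [NExpr.cost, Test.cost, ltN]
    nlinarith
  · obtain ⟨hf, -, h1, h2⟩ := hs'
    refine ⟨hf, h1, fun p q hpq hq => h2 0 p q (by simp) hpq ?_ hq⟩
    have := Nat.le_pow_clog (b := 2) (by norm_num) N
    omega

end MergeSort

end RealRAM

namespace RealRAM

/-! ### The separation program -/

/-- The total mass `P` of those of the first `k` entries of `idx` that belong to bidder `i`. -/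
noncomputable def prefixMass (bid idx : ℕ → ℕ) (P : ℕ → ℝ) (k i : ℕ) : ℝ :=
  ∑ p ∈ Finset.range k with bid (idx p) = i, P (idx p)

/-- The left-hand side of Border's inequality for the first `k` entries of `idx`. -/
noncomputable def prefixLoad (idx : ℕ → ℕ) (π P : ℕ → ℝ) (k : ℕ) : ℝ :=
  ∑ p ∈ Finset.range k, π (idx p) * P (idx p)

/-- The right-hand side of Border's inequality for the first `k` entries of `idx`. -/
noncomputable def prefixBound (m : ℕ) (bid idx : ℕ → ℕ) (P : ℕ → ℝ) (k : ℕ) : ℝ :=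
  1 - ∏ i ∈ Finset.range m, (1 - prefixMass bid idx P k i)

theorem prefixMass_succ (bid idx : ℕ → ℕ) (P : ℕ → ℝ) (k : ℕ) :
    prefixMass bid idx P (k + 1) = Function.update (prefixMass bid idx P k) (bid (idx k))
      (prefixMass bid idx P k (bid (idx k)) + P (idx k)) := by
  funext i
  unfold prefixMass
  rw [Finset.range_add_one, Finset.filter_insert]
  by_cases h : bid (idx k) = i
  · subst h
    simp [add_comm]
  · simp [h, Function.update_of_ne (Ne.symm h)]

theorem prefixLoad_succ (idx : ℕ → ℕ) (π P : ℕ → ℝ) (k : ℕ) :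
    prefixLoad idx π P (k + 1) = prefixLoad idx π P k + π (idx k) * P (idx k) :=
  Finset.sum_range_succ _ _

/-- `s` contains the same input data as `s₀`. -/
structure SameInput (s₀ s : State) : Prop where
  nvar₀ : s.nvar 0 = s₀.nvar 0
  nvar₁ : s.nvar 1 = s₀.nvar 1
  narr : s.narr 0 = s₀.narr 0
  rarr₀ : s.rarr 0 = s₀.rarr 0
  rarr₁ : s.rarr 1 = s₀.rarr 1

theorem SortFrame.sameInput {s s' : State} (h : SortFrame s s') : SameInput s s' :=
  ⟨h.nvar₀, h.nvar₁, h.narr, by rw [h.rarr], by rw [h.rarr]⟩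

theorem SameInput.trans {s s' s'' : State} (h : SameInput s s') (h' : SameInput s' s'') :
    SameInput s s'' :=
  ⟨h'.nvar₀.trans h.nvar₀, h'.nvar₁.trans h.nvar₁, h'.narr.trans h.narr,
    h'.rarr₀.trans h.rarr₀, h'.rarr₁.trans h.rarr₁⟩

theorem SameInput.of_eq {s s' s'' : State} (h : SameInput s s')
    (h0 : s''.nvar 0 = s'.nvar 0) (h1 : s''.nvar 1 = s'.nvar 1) (ha : s''.narr 0 = s'.narr 0)
    (hr₀ : s''.rarr 0 = s'.rarr 0) (hr₁ : s''.rarr 1 = s'.rarr 1) : SameInput s s'' :=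
  h.trans ⟨h0, h1, ha, hr₀, hr₁⟩

/-- The test `i < m` for the register `9` that holds `i`. -/
def ltM : Test := .nle (.add (.var 9) (.const 1)) (.var 1)

/-- Register `8` holds the position in the sorted array `1`. The mass seen so far is kept for each
bidder in the real array `3`; its product with the entry of `π`, negated because the largest
products are needed first, becomes the new key in the real array `4`. -/
def cumStep : Cmd :=
  .seq (.setN 10 (.read 1 (.var 8))) (.seq (.setN 11 (.read 0 (.var 10)))
    (.seq (.writeR 3 (.var 11) (.add (.read 3 (.var 11)) (.read 1 (.var 10))))
      (.seq (.writeR 4 (.var 10)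
          (.sub (.const 0) (.mul (.read 3 (.var 11)) (.read 0 (.var 10)))))
        (.setN 8 (.add (.var 8) (.const 1))))))

/-- Sets the real array `5` to `1` for one more bidder. -/
def onesStep : Cmd :=
  .seq (.writeR 5 (.var 9) (.const 1)) (.setN 9 (.add (.var 9) (.const 1)))

/-- Multiplies the real register `2` by one more entry of the real array `5`. -/
def prodStep : Cmd :=
  .seq (.setR 2 (.mul (.var 2) (.read 5 (.var 9)))) (.setN 9 (.add (.var 9) (.const 1)))

/-- Adds the next pair in the order of array `1` to the sets: the real array `5` holds the
probabilities `1 - Pr[tᵢ ∈ Sᵢ]`, the real register `1` the left-hand side of Border's inequality,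
the real array `2` the normal vector. -/
def addStep : Cmd :=
  .seq (.setN 10 (.read 1 (.var 8))) (.seq (.setN 11 (.read 0 (.var 10)))
    (.seq (.writeR 5 (.var 11) (.sub (.read 5 (.var 11)) (.read 1 (.var 10))))
      (.seq (.setR 1 (.add (.var 1) (.mul (.read 0 (.var 10)) (.read 1 (.var 10)))))
        (.seq (.writeR 2 (.var 10) (.read 1 (.var 10)))
          (.seq (.setR 2 (.const 1)) (.setN 9 (.const 0)))))))

/-- Unless a violated inequality has been found, adds the next pair and tests Border's
inequality. -/
def scanStep : Cmd :=
  .seq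
    (.ite (.nle (.const 1) (.var 2))
      (.seq addStep
        (.seq (.loop ltM prodStep)
          (.ite (.rle (.var 1) (.sub (.const 1) (.var 2))) .skip
            (.seq (.setN 2 (.const 0)) (.setR 0 (.sub (.const 1) (.var 2)))))))
      .skip)
    (.setN 8 (.add (.var 8) (.const 1)))

/-- Computes the keys for the second sorting. -/
def cumCmd : Cmd := .seq (.setN 8 (.const 0)) (.loop (ltN 8) cumStep)

/-- Tests Border's inequality for all prefixes of array `1`. -/
def scanCmd : Cmd :=
  .seq (.seq (.setN 2 (.const 1)) (.seq (.setR 1 (.const 0)) (.setN 9 (.const 0))))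
    (.seq (.loop ltM onesStep) (.seq (.setN 8 (.const 0)) (.loop (ltN 8) scanStep)))

/-- The separation program. The pairs `(i, A)` are sorted by `πᵢ(A)`, then by the product of
`πᵢ(A)` and the probability of the types of bidder `i` up to `A`; Border's inequality is tested for
the sets that consist of the largest products. -/
def separationProgram : Cmd :=
  .seq (sortCmd 0) (.seq cumCmd (.seq (sortCmd 4) scanCmd))

section Scan

variable {s₀ s : State} {N m : ℕ} {bid idx : ℕ → ℕ} {π P : ℕ → ℝ}

theorem cumCmd_spec (hN : s₀.nvar 0 = N) (hidx : IsIndexPerm N idx)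
    (hs : SameInput s₀ s ∧ s.narr 1 = idx ∧ s.rarr 2 = 0 ∧ s.rarr 3 = 0) :
    Runs cumCmd s (N * 50 + 50) fun s => SameInput s₀ s ∧ s.rarr 2 = 0 ∧
      ∀ q < N, s.rarr 4 (idx q)
        = -(prefixMass (s₀.narr 0) idx (s₀.rarr 1) (q + 1) (s₀.narr 0 (idx q))
          * s₀.rarr 0 (idx q)) := by
  unfold cumCmd
  refine Runs.mono (Runs.seq (P := fun s => SameInput s₀ s ∧ s.narr 1 = idx ∧ s.rarr 2 = 0 ∧
      s.nvar 8 = 0 ∧ s.rarr 3 = prefixMass (s₀.narr 0) idx (s₀.rarr 1) 0 ∧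
      ∀ q < 0, s.rarr 4 (idx q)
        = -(prefixMass (s₀.narr 0) idx (s₀.rarr 1) (q + 1) (s₀.narr 0 (idx q))
          * s₀.rarr 0 (idx q)))
    (Cmd.StraightLine.runs (t := 10) (by simp [Cmd.StraightLine, Cmd.time, NExpr.cost]) ?_)
    fun s hs => Runs.loop (n := N) (I := fun k s => SameInput s₀ s ∧ s.narr 1 = idx ∧
      s.rarr 2 = 0 ∧ s.nvar 8 = k ∧ s.rarr 3 = prefixMass (s₀.narr 0) idx (s₀.rarr 1) k ∧
      ∀ q < k, s.rarr 4 (idx q)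
        = -(prefixMass (s₀.narr 0) idx (s₀.rarr 1) (q + 1) (s₀.narr 0 (idx q))
          * s₀.rarr 0 (idx q)))
      (fun k hk s hs => ⟨?_, Cmd.StraightLine.runs (t := 40)
        (by simp [cumStep, Cmd.StraightLine, Cmd.time, NExpr.cost, RExpr.cost]) ?_⟩)
      (fun s hs => ?_) hs) ?_ fun s hs => ⟨hs.1, hs.2.2.1, hs.2.2.2.2.2⟩
  · obtain ⟨hf, h1, h2, h3⟩ := hs
    refine ⟨hf.of_eq ?_ ?_ ?_ ?_ ?_, ?_, ?_, ?_, ?_, by simp⟩ <;>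
      simp [Cmd.run, NExpr.eval, h1, h2, h3]
    funext i
    simp [prefixMass]
  · obtain ⟨hf, -, -, h8, -⟩ := hs
    simp only [ltN, Test.Holds, NExpr.eval, h8, hf.nvar₀.trans hN]
    omega
  · obtain ⟨hf, h1, h2, h8, h3, h4⟩ := hs
    simp only [cumStep, Cmd.run, NExpr.eval, RExpr.eval]
    refine ⟨hf.of_eq ?_ ?_ ?_ ?_ ?_, ?_, ?_, ?_, ?_, fun q hq => ?_⟩
    · simp
    · simp
    · simp
    · simp
    · simp
    · simpa using h1
    · simpa using h2
    · simp [h8]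
    · simp [h8, h1, h3, hf.narr, hf.rarr₁, prefixMass_succ]
    · rcases Nat.lt_succ_iff_lt_or_eq.mp hq with hlt | rfl
      · have hne : idx q ≠ idx k := fun he => hlt.ne (hidx.2 q (by omega) k hk he)
        simpa [h8, h1, hne] using h4 q hlt
      · simp [h8, h1, h3, hf.narr, hf.rarr₁, hf.rarr₀, prefixMass_succ]
  · obtain ⟨hf, -, -, h8, -⟩ := hs
    simp only [ltN, Test.Holds, NExpr.eval, h8, hf.nvar₀.trans hN]
    omega
  · simp only [ltN, Test.cost, NExpr.cost]
    omega

/-- The vector `w` agrees with `P` on the first `k` entries of `idx` and vanishes elsewhere. -/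
def IsPrefixNormal (idx : ℕ → ℕ) (P : ℕ → ℝ) (k : ℕ) (w : ℕ → ℝ) : Prop :=
  (∀ p < k, w (idx p) = P (idx p)) ∧ ∀ j, (∀ p < k, idx p ≠ j) → w j = 0

/-- The state of the search after the first `k` prefixes: either none of them violates Border's
inequality, or the data of a violated inequality have been recorded. -/
def ScanResult (m : ℕ) (bid idx : ℕ → ℕ) (π P : ℕ → ℝ) (k : ℕ) (s : State) : Prop :=
  (s.nvar 2 = 1 ∧ (∀ l ≤ k, prefixLoad idx π P l ≤ prefixBound m bid idx P l) ∧
    s.rvar 1 = prefixLoad idx π P k ∧ (∀ i < m, s.rarr 5 i = 1 - prefixMass bid idx P k i) ∧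
    IsPrefixNormal idx P k (s.rarr 2)) ∨
  (s.nvar 2 = 0 ∧ ∃ l ≤ k, prefixBound m bid idx P l < prefixLoad idx π P l ∧
    s.rvar 0 = prefixBound m bid idx P l ∧ IsPrefixNormal idx P l (s.rarr 2))

theorem scanStep_spec {k : ℕ} (hm : s₀.nvar 1 = m) (hs : SameInput s₀ s ∧ s.narr 1 = idx ∧
      s.nvar 8 = k ∧ ScanResult m (s₀.narr 0) idx (s₀.rarr 0) (s₀.rarr 1) k s) :
    Runs scanStep s (m * 20 + 100) fun s => SameInput s₀ s ∧ s.narr 1 = idx ∧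
      s.nvar 8 = k + 1 ∧ ScanResult m (s₀.narr 0) idx (s₀.rarr 0) (s₀.rarr 1) (k + 1) s := by
  set bid := s₀.narr 0 with hbid
  set π := s₀.rarr 0 with hπ
  set P := s₀.rarr 1 with hP
  obtain ⟨hf, h1, h8, hres⟩ := hs
  unfold scanStep
  refine Runs.mono (Runs.seq (t₁ := 3 + (m * 20 + 80)) (t₂ := 10)
    (P := fun s => SameInput s₀ s ∧ s.narr 1 = idx ∧ s.nvar 8 = k ∧
      ScanResult m bid idx π P (k + 1) s)
    (Runs.ite (fun h => ?_) fun h => ?_)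
    fun s hs => Cmd.StraightLine.runs (by simp [Cmd.StraightLine, Cmd.time, NExpr.cost]) ?_)
    (by omega) fun _ => id
  · rcases hres with ⟨h2, hok, hload, hmass, hnormal⟩ | ⟨h2, -⟩
    swap
    · simp [Test.Holds, NExpr.eval, h2] at h
    have hne : ∀ l ≤ k + 1, l ≠ k + 1 → l ≤ k := fun l h h' => by omega
    refine Runs.mono (Runs.seq (P := fun s => SameInput s₀ s ∧ s.narr 1 = idx ∧ s.nvar 8 = k ∧
        s.nvar 2 = 1 ∧ s.rvar 1 = prefixLoad idx π P (k + 1) ∧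
        (∀ i < m, s.rarr 5 i = 1 - prefixMass bid idx P (k + 1) i) ∧
        IsPrefixNormal idx P (k + 1) (s.rarr 2) ∧ s.nvar 9 = 0 ∧
        s.rvar 2 = ∏ i ∈ Finset.range 0, (1 - prefixMass bid idx P (k + 1) i))
      (Cmd.StraightLine.runs (t := 40)
        (by simp [addStep, Cmd.StraightLine, Cmd.time, NExpr.cost, RExpr.cost]) ?_)
      fun s hs => Runs.seq (Runs.loop (n := m)
        (I := fun l s => SameInput s₀ s ∧ s.narr 1 = idx ∧ s.nvar 8 = k ∧
          s.nvar 2 = 1 ∧ s.rvar 1 = prefixLoad idx π P (k + 1) ∧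
          (∀ i < m, s.rarr 5 i = 1 - prefixMass bid idx P (k + 1) i) ∧
          IsPrefixNormal idx P (k + 1) (s.rarr 2) ∧ s.nvar 9 = l ∧
          s.rvar 2 = ∏ i ∈ Finset.range l, (1 - prefixMass bid idx P (k + 1) i))
        (fun l hl s hs => ⟨?_, Cmd.StraightLine.runs (t := 10)
          (by simp [prodStep, Cmd.StraightLine, Cmd.time, NExpr.cost, RExpr.cost]) ?_⟩)
        (fun s hs => ?_) hs)
      fun s hs => Runs.ite (t := 10)
        (fun hle => Cmd.StraightLine.runs (by simp [Cmd.StraightLine, Cmd.time]) ?_)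
        fun hlt => Cmd.StraightLine.runs
          (by simp [Cmd.StraightLine, Cmd.time, NExpr.cost, RExpr.cost]) ?_) ?_ fun _ => id
    · simp only [addStep, Cmd.run, NExpr.eval, RExpr.eval]
      refine ⟨hf.of_eq ?_ ?_ ?_ ?_ ?_, ?_, ?_, ?_, ?_, fun i hi => ?_, ⟨fun p hp => ?_,
        fun j hj => ?_⟩, ?_, ?_⟩
      · simp
      · simp
      · simp
      · simp
      · simp
      · simpa using h1
      · simpa using h8
      · simpa using h2
      · simp [h8, h1, hf.rarr₀, hf.rarr₁, hload, prefixLoad_succ, hπ, hP]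
      · by_cases hb : i = bid (idx k)
        · subst hb
          simp [h8, h1, hf.narr, hf.rarr₁, prefixMass_succ, hmass _ hi, ← hbid, ← hP]
          ring
        · simpa [h8, h1, hf.narr, hf.rarr₁, prefixMass_succ, ← hbid, hb] using hmass i hi
      · by_cases he : idx p = idx k
        · simp [h8, h1, hf.rarr₁, he, hP]
        · have hp' : p < k := by
            rcases Nat.lt_succ_iff_lt_or_eq.mp hp with hlt | rfl
            · exact hlt
            · exact absurd rfl he
          simpa [h8, h1, he] using hnormal.1 p hp'
      · have hjk : j ≠ idx k := (hj k (by omega)).symm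
        simpa [h8, h1, hjk] using hnormal.2 j fun p hp => hj p (by omega)
      · simp
      · simp
    · obtain ⟨hf, -, -, -, -, -, -, h9, -⟩ := hs
      simp only [ltM, Test.Holds, NExpr.eval, h9, hf.nvar₁.trans hm]
      omega
    · obtain ⟨hf, h1, h8, h2, hload, hmass, hnormal, h9, hprod⟩ := hs
      simp only [prodStep, Cmd.run, NExpr.eval, RExpr.eval]
      refine ⟨hf.of_eq ?_ ?_ ?_ ?_ ?_, h1, ?_, ?_, ?_, hmass, hnormal, ?_, ?_⟩
      · simp
      · simp
      · simp
      · simp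
      · simp
      · simpa using h8
      · simpa using h2
      · simpa using hload
      · simp [h9]
      · simp [h9, hprod, Finset.prod_range_succ, hmass l hl]
    · obtain ⟨hf, -, -, -, -, -, -, h9, -⟩ := hs
      simp only [ltM, Test.Holds, NExpr.eval, h9, hf.nvar₁.trans hm]
      omega
    · obtain ⟨hf, h1, h8, h2, hload, hmass, hnormal, h9, hprod⟩ := hs
      refine ⟨hf, h1, h8, .inl ⟨h2, fun l hl => ?_, hload, hmass, hnormal⟩⟩
      by_cases hlk : l = k + 1
      · subst hlk
        simpa [Test.Holds, RExpr.eval, hload, hprod, prefixBound] using hle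
      · exact hok l (by omega)
    · obtain ⟨hf, h1, h8, h2, hload, hmass, hnormal, h9, hprod⟩ := hs
      simp only [Cmd.run, NExpr.eval, RExpr.eval]
      refine ⟨hf.of_eq ?_ ?_ ?_ ?_ ?_, h1, ?_, .inr ⟨?_, k + 1, le_rfl, ?_, ?_, hnormal⟩⟩
      · simp
      · simp
      · simp
      · simp
      · simp
      · simpa using h8
      · simp
      · simpa [Test.Holds, RExpr.eval, hload, hprod, prefixBound] using hlt
      · simp [hprod, prefixBound]
    · simp only [ltM, Test.cost, NExpr.cost, RExpr.cost]
      omega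
  · rcases hres with ⟨h2, -⟩ | ⟨h2, l, hl, hviol, hb, hnormal⟩
    · simp [Test.Holds, NExpr.eval, h2] at h
    · exact Runs.mono (Cmd.StraightLine.runs (t := 10) (by simp [Cmd.StraightLine, Cmd.time])
        ⟨hf, h1, h8, .inr ⟨h2, l, by omega, hviol, hb, hnormal⟩⟩) (by omega) fun _ => id
  · obtain ⟨hf, h1, h8, hres⟩ := hs
    refine ⟨hf.of_eq ?_ ?_ ?_ ?_ ?_, h1, ?_, ?_⟩
    · simp [Cmd.run]
    · simp [Cmd.run]
    · simp [Cmd.run]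
    · simp [Cmd.run]
    · simp [Cmd.run]
    · simp [Cmd.run, NExpr.eval, h8]
    · simpa [Cmd.run, ScanResult] using hres

theorem scanCmd_spec (hN : s₀.nvar 0 = N) (hm : s₀.nvar 1 = m)
    (hs : SameInput s₀ s ∧ s.narr 1 = idx ∧ s.rarr 2 = 0) :
    Runs scanCmd s (N * (m * 20 + 110) + m * 20 + 50) fun s =>
      ScanResult m (s₀.narr 0) idx (s₀.rarr 0) (s₀.rarr 1) N s := by
  unfold scanCmd
  refine Runs.mono (Runs.seq (P := fun s => SameInput s₀ s ∧ s.narr 1 = idx ∧ s.rarr 2 = 0 ∧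
      s.nvar 2 = 1 ∧ s.rvar 1 = 0 ∧ s.nvar 9 = 0 ∧ ∀ i < 0, s.rarr 5 i = 1)
    (Cmd.StraightLine.runs (t := 10)
      (by simp [Cmd.StraightLine, Cmd.time, NExpr.cost, RExpr.cost]) ?_)
    fun s hs => Runs.seq (Runs.loop (n := m)
      (I := fun l s => SameInput s₀ s ∧ s.narr 1 = idx ∧ s.rarr 2 = 0 ∧
        s.nvar 2 = 1 ∧ s.rvar 1 = 0 ∧ s.nvar 9 = l ∧ ∀ i < l, s.rarr 5 i = 1)
      (fun l hl s hs => ⟨?_, Cmd.StraightLine.runs (t := 10)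
        (by simp [onesStep, Cmd.StraightLine, Cmd.time, NExpr.cost, RExpr.cost]) ?_⟩)
      (fun s hs => ?_) hs)
    fun s hs => Runs.seq (P := fun s => SameInput s₀ s ∧ s.narr 1 = idx ∧
        s.nvar 8 = 0 ∧ ScanResult m (s₀.narr 0) idx (s₀.rarr 0) (s₀.rarr 1) 0 s)
      (Cmd.StraightLine.runs (t := 10) (by simp [Cmd.StraightLine, Cmd.time, NExpr.cost]) ?_)
    fun s hs => Runs.loop (n := N) (I := fun k s => SameInput s₀ s ∧ s.narr 1 = idx ∧
        s.nvar 8 = k ∧ ScanResult m (s₀.narr 0) idx (s₀.rarr 0) (s₀.rarr 1) k s)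
      (fun k hk s hs => ⟨?_, scanStep_spec hm hs⟩) (fun s hs => ?_) hs) ?_ fun s hs => hs.2.2.2
  · obtain ⟨hf, h1, h2⟩ := hs
    refine ⟨hf.of_eq ?_ ?_ ?_ ?_ ?_, ?_, ?_, ?_, ?_, ?_, by simp⟩ <;>
      simp [Cmd.run, NExpr.eval, RExpr.eval, h1, h2]
  · obtain ⟨hf, -, -, -, -, h9, -⟩ := hs
    simp only [ltM, Test.Holds, NExpr.eval, h9, hf.nvar₁.trans hm]
    omega
  · obtain ⟨hf, h1, hr2, h2, hload, h9, h5⟩ := hs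
    simp only [onesStep, Cmd.run, NExpr.eval, RExpr.eval]
    refine ⟨hf.of_eq ?_ ?_ ?_ ?_ ?_, h1, ?_, ?_, hload, ?_, fun i hi => ?_⟩
    · simp
    · simp
    · simp
    · simp
    · simp
    · simpa using hr2
    · simpa using h2
    · simp [h9]
    · rcases Nat.lt_succ_iff_lt_or_eq.mp hi with hlt | rfl
      · simpa [h9, hlt.ne] using h5 i hlt
      · simp [h9]
  · obtain ⟨hf, -, -, -, -, h9, -⟩ := hs
    simp only [ltM, Test.Holds, NExpr.eval, h9, hf.nvar₁.trans hm]
    omega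
  · obtain ⟨hf, h1, hr2, h2, hload, h9, h5⟩ := hs
    simp only [Cmd.run, NExpr.eval]
    refine ⟨hf.of_eq ?_ ?_ ?_ ?_ ?_, h1, ?_, .inl ⟨?_, fun l hl => ?_, ?_, fun i hi => ?_, ?_, ?_⟩⟩
    · simp
    · simp
    · simp
    · simp
    · simp
    · simp
    · simpa using h2
    · obtain rfl : l = 0 := by omega
      simp [prefixLoad, prefixBound, prefixMass]
    · simpa [prefixLoad] using hload
    · simpa [prefixMass] using h5 i hi
    · simp
    · simp [hr2]
  · obtain ⟨hf, -, h8, -⟩ := hs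
    simp only [ltN, Test.Holds, NExpr.eval, h8, hf.nvar₀.trans hN]
    omega
  · obtain ⟨hf, -, h8, -⟩ := hs
    simp only [ltN, Test.Holds, NExpr.eval, h8, hf.nvar₀.trans hN]
    omega
  · simp only [ltM, ltN, Test.cost, NExpr.cost]
    nlinarith

/-- The program sorts by `π`, then by the products of `π` and the cumulated masses, and reports on
the prefixes of the second order. -/
theorem separationProgram_spec (hN : s.nvar 0 = N) (hm : s.nvar 1 = m) (hN1 : 1 ≤ N)
    (h2 : s.rarr 2 = 0) (h3 : s.rarr 3 = 0) :
    Runs separationProgram s (N * (Nat.clog 2 N + m + 1) * 1500) fun s' =>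
      ∃ idx₁ idx₂ : ℕ → ℕ, IsIndexPerm N idx₁ ∧ IsIndexPerm N idx₂ ∧
        (∀ p q, p ≤ q → q < N → s.rarr 0 (idx₁ p) ≤ s.rarr 0 (idx₁ q)) ∧
        ∃ key : ℕ → ℝ,
          (∀ q < N, key (idx₁ q) = -(prefixMass (s.narr 0) idx₁ (s.rarr 1) (q + 1)
            (s.narr 0 (idx₁ q)) * s.rarr 0 (idx₁ q))) ∧
          (∀ p q, p ≤ q → q < N → key (idx₂ p) ≤ key (idx₂ q)) ∧
          ScanResult m (s.narr 0) idx₂ (s.rarr 0) (s.rarr 1) N s' := by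
  obtain ⟨s₁, k₁, he₁, hk₁, hf₁, hp₁, hs₁⟩ := sortCmd_spec 0 hN hN1
  obtain ⟨s₂, k₂, he₂, hk₂, hf₂, h22, h24⟩ := cumCmd_spec (s₀ := s) (s := s₁) hN hp₁
    ⟨hf₁.sameInput, rfl, by rw [hf₁.rarr, h2], by rw [hf₁.rarr, h3]⟩
  obtain ⟨s₃, k₃, he₃, hk₃, hf₃, hp₃, hs₃⟩ := sortCmd_spec (s := s₂) 4 (hf₂.nvar₀.trans hN) hN1
  obtain ⟨s₄, k₄, he₄, hk₄, hr⟩ := scanCmd_spec (s₀ := s) (s := s₃) hN hm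
    ⟨hf₂.trans hf₃.sameInput, rfl, by rw [hf₃.rarr, h22]⟩
  refine ⟨s₄, _, he₁.seq (he₂.seq (he₃.seq he₄)), ?_, s₁.narr 1, s₃.narr 1, hp₁, hp₃, hs₁,
    s₂.rarr 4, h24, hs₃, hr⟩
  have h5 : m ≤ N * m := Nat.le_mul_of_pos_left m hN1
  have e1 : N * (Nat.clog 2 N + 1) * 600 = 600 * (N * Nat.clog 2 N) + 600 * N := by ring
  have e2 : N * (m * 20 + 110) = 20 * (N * m) + 110 * N := by ring
  have e3 : N * (Nat.clog 2 N + m + 1) * 1500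
      = 1500 * (N * Nat.clog 2 N) + 1500 * (N * m) + 1500 * N := by ring
  omega

end Scan

end RealRAM

/-! ### Correctness of the separation program -/

namespace RealRAM

/-- The rank of every element of a listed type in the order of `idx`. -/
theorem IsIndexPerm.exists_rank {N : ℕ} {idx : ℕ → ℕ} (h : IsIndexPerm N idx) {X : Type*}
    (e : X ≃ Fin N) : ∃ τ : X ≃ Fin N, ∀ x, idx (τ x) = e x := by
  have hinj : Function.Injective fun p : Fin N => (⟨idx p, h.1 p p.2⟩ : Fin N) := fun p q hpq =>
    Fin.ext (h.2 p p.2 q q.2 (Fin.mk.inj_iff.mp hpq))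
  let σ := Equiv.ofBijective _ (Finite.injective_iff_bijective.mp hinj)
  refine ⟨e.trans σ.symm, fun x => ?_⟩
  exact congrArg Fin.val (σ.apply_symm_apply (e x))

theorem sum_range_eq_sum_rank {N k : ℕ} {X : Type*} [Fintype X] (τ : X ≃ Fin N) (hk : k ≤ N)
    (f : ℕ → ℝ) : ∑ p ∈ Finset.range k, f p = ∑ x, if (τ x : ℕ) < k then f (τ x) else 0 := by
  rw [Equiv.sum_comp τ fun p : Fin N => if (p : ℕ) < k then f p else 0,
    Fin.sum_univ_eq_sum_range (fun p => if p < k then f p else 0) N, ← Finset.sum_filter]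
  congr 1
  ext p
  simp only [Finset.mem_range, Finset.mem_filter]
  omega

end RealRAM

namespace Auction

open RealRAM

section Correctness

open scoped Classical

variable {m : ℕ} {T : Fin m → Type u} [∀ i, Fintype (T i)] {N k : ℕ}
  {e τ : (Σ i, T i) ≃ Fin N} {bid idx : ℕ → ℕ} {πN P : ℕ → ℝ} {π p : ∀ i, T i → ℝ}

/-- The types of bidder `i` among the first `k` pairs in the order of `τ`. -/
noncomputable def prefixSet (τ : (Σ i, T i) ≃ Fin N) (k : ℕ) (i : Fin m) : Finset (T i) :=
  Finset.univ.filter fun A => (τ ⟨i, A⟩ : ℕ) < k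

theorem prefixMass_eq (hτ : ∀ x, idx (τ x) = e x) (hbid : ∀ x, bid (e x) = (x.1 : ℕ))
    (hP : ∀ x, P (e x) = p x.1 x.2) (hk : k ≤ N) (i : Fin m) :
    prefixMass bid idx P k i = ∑ A ∈ prefixSet τ k i, p i A := by
  unfold prefixMass
  rw [Finset.sum_filter, sum_range_eq_sum_rank τ hk, Fintype.sum_sigma]
  simp only [hτ, hbid, hP]
  rw [Finset.sum_eq_single i]
  · simp [prefixSet, Finset.sum_filter]
  · intro j _ hj
    refine Finset.sum_eq_zero fun A _ => ?_
    rw [if_neg (fun h => hj (Fin.ext h)), ite_self]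
  · simp

theorem borderExcess_prefixSet (hτ : ∀ x, idx (τ x) = e x)
    (hbid : ∀ x, bid (e x) = (x.1 : ℕ)) (hP : ∀ x, P (e x) = p x.1 x.2)
    (hπ : ∀ x, πN (e x) = π x.1 x.2) (hk : k ≤ N) :
    borderExcess p π (prefixSet τ k) = prefixLoad idx πN P k - prefixBound m bid idx P k := by
  unfold borderExcess prefixLoad prefixBound
  rw [Finset.prod_range fun i => 1 - prefixMass bid idx P k i, sum_range_eq_sum_rank τ hk,
    Fintype.sum_sigma]
  simp only [hτ, hP, hπ, prefixMass_eq hτ hbid hP hk, prefixSet, Finset.sum_filter]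

/-- Every set `{A | x < hᵢ(A)}` consists of the types in a prefix of an order in which `h`
decreases. -/
theorem exists_prefixSet_eq (h : ∀ i, T i → ℝ)
    (hanti : ∀ y z, τ y ≤ τ z → h z.1 z.2 ≤ h y.1 y.2) (x : ℝ) :
    ∃ k ≤ N, ∀ i, (Finset.univ.filter fun A => x < h i A) = prefixSet τ k i := by
  have hex : ∃ k, ∀ y : Σ i, T i, k ≤ (τ y : ℕ) → ¬ x < h y.1 y.2 :=
    ⟨N, fun y hy => absurd (τ y).2 (not_lt.mpr hy)⟩
  obtain ⟨k, hk, hmin⟩ : ∃ k, (∀ y : Σ i, T i, k ≤ (τ y : ℕ) → ¬ x < h y.1 y.2) ∧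
      ∀ l < k, ¬ ∀ y : Σ i, T i, l ≤ (τ y : ℕ) → ¬ x < h y.1 y.2 :=
    ⟨Nat.find hex, Nat.find_spec hex, fun l => Nat.find_min hex⟩
  refine ⟨k, not_lt.mp fun hlt => hmin N hlt fun y hy => absurd (τ y).2 (not_lt.mpr hy),
    fun i => Finset.filter_congr fun A _ => ⟨fun hx => ?_, fun hlt => ?_⟩⟩
  · by_contra! hle
    exact hk ⟨i, A⟩ hle hx
  · have := hmin _ hlt
    push Not at this
    obtain ⟨z, hz, hxz⟩ := this
    exact hxz.trans_le (hanti ⟨i, A⟩ z hz)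

variable [∀ i, MeasurableSpace (T i)] [∀ i, MeasurableSingletonClass (T i)]
  {D : Measure (∀ i, T i)} [IsProbabilityMeasure D]

/-- The memory reached by the separation program is a correct output. -/
theorem correctOutput_of_scanResult
    (hD : iIndepFun (fun (i : Fin m) (t : ∀ j, T j) => t i) D) (hπ : IsReducedForm π)
    (hbid : ∀ x, bid (e x) = (x.1 : ℕ)) (hP : ∀ x, P (e x) = typeProb D x.1 x.2)
    (hπN : ∀ x, πN (e x) = π x.1 x.2) {idx₁ idx₂ : ℕ → ℕ} {key : ℕ → ℝ}
    (h₁ : IsIndexPerm N idx₁) (h₂ : IsIndexPerm N idx₂)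
    (hs₁ : ∀ p q, p ≤ q → q < N → πN (idx₁ p) ≤ πN (idx₁ q))
    (hkey : ∀ q < N, key (idx₁ q)
      = -(prefixMass bid idx₁ P (q + 1) (bid (idx₁ q)) * πN (idx₁ q)))
    (hs₂ : ∀ p q, p ≤ q → q < N → key (idx₂ p) ≤ key (idx₂ q)) {s : State}
    (hs : ScanResult m bid idx₂ πN P N s) : CorrectOutput e D π s := by
  obtain ⟨τ₁, hτ₁⟩ := h₁.exists_rank e
  obtain ⟨τ₂, hτ₂⟩ := h₂.exists_rank e
  rcases hs with ⟨h2, hok, -⟩ | ⟨h2, l, hl, hviol, hb, hnormal⟩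
  · refine .inl ⟨h2, feasible_of_threshold hD (g := fun i A =>
      ∑ B ∈ prefixSet τ₁ (τ₁ ⟨i, A⟩ + 1) i, typeProb D i B) hπ (fun i A => ?_) (fun i A => ?_)
      fun x => ?_⟩
    · rw [add_comm, ← Finset.sum_insert (by simp)]
      refine Finset.sum_le_sum_of_subset_of_nonneg (fun B hB => ?_)
        fun B _ _ => measureReal_nonneg
      rcases Finset.mem_insert.mp hB with rfl | hB
      · simp [prefixSet]
      · have hlt := (Finset.mem_filter.mp hB).2
        simp only [prefixSet, Finset.mem_filter, Finset.mem_univ, true_and]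
        by_contra! hle
        have := hs₁ (τ₁ ⟨i, A⟩) (τ₁ ⟨i, B⟩) (by omega) (τ₁ ⟨i, B⟩).2
        rw [hτ₁, hτ₁, hπN, hπN] at this
        exact absurd hlt (not_lt.mpr this)
    · refine Finset.sum_le_sum_of_subset_of_nonneg (fun B hB => ?_)
        fun B _ _ => measureReal_nonneg
      simp only [prefixSet, Finset.mem_filter, Finset.mem_univ, true_and] at hB ⊢
      have := hs₁ (τ₁ ⟨i, B⟩) (τ₁ ⟨i, A⟩) (by omega) (τ₁ ⟨i, A⟩).2
      rwa [hτ₁, hτ₁, hπN, hπN] at this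
    · have hk : ∀ y : Σ i, T i, key (e y)
          = -((∑ B ∈ prefixSet τ₁ (τ₁ y + 1) y.1, typeProb D y.1 B) * π y.1 y.2) := by
        intro y
        have := hkey (τ₁ y) (τ₁ y).2
        rwa [hτ₁, hbid, hπN, prefixMass_eq hτ₁ hbid hP (τ₁ y).2] at this
      obtain ⟨k, hkN, hset⟩ := exists_prefixSet_eq (τ := τ₂)
        (fun i A => (∑ B ∈ prefixSet τ₁ (τ₁ ⟨i, A⟩ + 1) i, typeProb D i B) * π i A)
        (fun y z hyz => by
          have := hs₂ (τ₂ y) (τ₂ z) hyz (τ₂ z).2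
          rw [hτ₂, hτ₂, hk, hk] at this
          exact neg_le_neg_iff.mp this) x
      rw [funext hset, borderExcess_prefixSet hτ₂ hbid hP hπN hkN]
      linarith [hok k hkN]
  · have hsep := separates_of_borderExcess_pos hD (π := π) (prefixSet τ₂ l)
      (by rw [borderExcess_prefixSet hτ₂ hbid hP hπN hl]; linarith)
    have hw : (fun i A => s.rarr 2 (e ⟨i, A⟩))
        = fun i A => if A ∈ prefixSet τ₂ l i then typeProb D i A else 0 := by
      funext i A
      by_cases hA : A ∈ prefixSet τ₂ l i
      · have hlt : (τ₂ ⟨i, A⟩ : ℕ) < l := (Finset.mem_filter.mp hA).2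
        rw [if_pos hA, ← hτ₂, hnormal.1 _ hlt, hτ₂, hP]
      · rw [if_neg hA]
        refine hnormal.2 _ fun p hp he => hA ?_
        rw [← hτ₂] at he
        have := h₂.2 p (by omega) _ (τ₂ ⟨i, A⟩).2 he
        simpa [prefixSet, ← this] using hp
    have hb' : s.rvar 0 = 1 - ∏ i, (1 - ∑ A ∈ prefixSet τ₂ l i, typeProb D i A) := by
      rw [hb, prefixBound, Finset.prod_range fun i => 1 - prefixMass bid idx₂ P l i]
      simp only [prefixMass_eq hτ₂ hbid hP hl]
    rw [← hw, ← hb'] at hsep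
    exact .inr ⟨h2, fun hfeas => absurd hsep.2.2 (not_lt.mpr (hsep.2.1 π ⟨hπ, hfeas⟩)), hsep⟩

end Correctness

section Input

variable {m : ℕ} {T : Fin m → Type u} [∀ i, MeasurableSpace (T i)] {N : ℕ}
  (e : (Σ i, T i) ≃ Fin N) (D : Measure (∀ i, T i)) (π : ∀ i, T i → ℝ) (x : Σ i, T i)

theorem inputState_bidder : (inputState e D π).narr 0 (e x) = (x.1 : ℕ) := by
  simp [inputState]

theorem inputState_form : (inputState e D π).rarr 0 (e x) = π x.1 x.2 := by
  obtain ⟨j, rfl⟩ := e.symm.surjective x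
  simp [inputState]

theorem inputState_prob : (inputState e D π).rarr 1 (e x) = typeProb D x.1 x.2 := by
  obtain ⟨j, rfl⟩ := e.symm.surjective x
  simp [inputState]

end Input

theorem clog_add_le {N m : ℕ} (hN : 1 ≤ N) (hm : 1 ≤ m) :
    ((Nat.clog 2 N + m + 1 : ℕ) : ℝ) ≤ 3 * (Real.log N + m) := by
  have hlog : 0 ≤ Real.log N := Real.log_natCast_nonneg N
  have h2 := Real.log_two_gt_d9
  have h1 : (Nat.clog 2 N : ℝ) ≤ 2 * Real.log N + 1 := by
    have hlogb : Real.logb 2 N ≤ 2 * Real.log N := by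
      rw [Real.logb, div_le_iff₀ (by linarith)]
      nlinarith
    have hclog : Nat.clog 2 N = ⌈Real.logb 2 N⌉₊ := by
      exact_mod_cast (Real.natCeil_logb_natCast 2 N).symm
    have := Nat.ceil_lt_add_one (Real.logb_nonneg one_lt_two
      (by exact_mod_cast hN : (1 : ℝ) ≤ N))
    rw [hclog]
    linarith
  have hm' : (1 : ℝ) ≤ m := by exact_mod_cast hm
  push_cast
  linarith

end Auction

theorem mainTheorem2 :
    (∀ (m : ℕ) (T : Fin m → Type u) [∀ i, Fintype (T i)] [∀ i, MeasurableSpace (T i)]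
        [∀ i, MeasurableSingletonClass (T i)]
        (D : Measure (∀ i, T i)) [IsProbabilityMeasure D],
        iIndepFun (fun (i : Fin m) (t : ∀ j, T j) => t i) D →
        ∀ π : ∀ i, T i → ℝ, Auction.IsReducedForm π →
          (Auction.Feasible D π ↔
            ∀ x : ℝ, Auction.BorderInequality D π (Auction.virtualUpperSet D π x))) ∧
    (∃ (prog : RealRAM.Cmd) (C : ℝ),
      ∀ (m : ℕ) (T : Fin m → Type u) [∀ i, Fintype (T i)] [∀ i, MeasurableSpace (T i)]
        [∀ i, MeasurableSingletonClass (T i)]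
        (D : Measure (∀ i, T i)) [IsProbabilityMeasure D],
        1 ≤ m →
        iIndepFun (fun (i : Fin m) (t : ∀ j, T j) => t i) D →
        ∀ π : ∀ i, T i → ℝ, Auction.IsReducedForm π →
          ∀ (N : ℕ) (e : (Σ i, T i) ≃ Fin N),
            ∃ (s : RealRAM.State) (k : ℕ),
              RealRAM.Exec prog (Auction.inputState e D π) s k ∧
              Auction.CorrectOutput e D π s ∧
              (k : ℝ) ≤ C * (N * (Real.log N + m))) := by

  refine ⟨fun m T _ _ _ D _ hD π hπ => Auction.feasible_iff_virtualUpperSet hD hπ,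
    RealRAM.separationProgram, 4500, fun m T _ _ _ D _ hm hD π hπ N e => ?_⟩
  obtain ⟨t⟩ : Nonempty (∀ i, T i) := nonempty_of_isProbabilityMeasure D
  have hN : 1 ≤ N := Nat.one_le_of_lt (e ⟨⟨0, hm⟩, t _⟩).2
  obtain ⟨s, k, hexec, hk, idx₁, idx₂, h₁, h₂, hs₁, key, hkey, hs₂, hscan⟩ :=
    RealRAM.separationProgram_spec (s := Auction.inputState e D π) (N := N) (m := m)
      rfl rfl hN (by funext j; simp [Auction.inputState]) (by funext j; simp [Auction.inputState])
  refine ⟨s, k, hexec, Auction.correctOutput_of_scanResult hD hπ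
    (Auction.inputState_bidder e D π) (Auction.inputState_prob e D π)
    (Auction.inputState_form e D π) h₁ h₂ hs₁ hkey hs₂ hscan, ?_⟩
  calc (k : ℝ) ≤ ((N * (Nat.clog 2 N + m + 1) * 1500 : ℕ) : ℝ) := by exact_mod_cast hk
    _ = N * 1500 * ((Nat.clog 2 N + m + 1 : ℕ) : ℝ) := by push_cast; ring
    _ ≤ N * 1500 * (3 * (Real.log N + m)) :=
      mul_le_mul_of_nonneg_left (Auction.clog_add_le hN hm) (by positivity)
    _ = 4500 * (N * (Real.log N + m)) := by ring
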